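/- Let $M$ be a non-degenerate $d\times d$ integer matrix all of whose (complex) eigenvalues are bigger than $1$ in modulus, and let $m=|\det M|$. For $\psi^{(1)},\dots,\psi^{(r)},\widetilde\psi^{(1)},\dots,\widetilde\psi^{(r)}\in L_2(\mathbb R^d)$ put, for $j\in\mathbb Z$, $k\in\mathbb Z^d$, $$\psi^{(\nu)}_{jk}=m^{j/2}\psi^{(\nu)}(M^j\cdot+k),\qquad \widetilde\psi^{(\nu)}_{jk}=m^{j/2}\widetilde\psi^{(\nu)}(M^j\cdot+k).$$ Assume that $\{\psi^{(\nu)}_{jk}\}$ and $\{\widetilde\psi^{(\nu)}_{jk}\}$ are dual wavelet frames: there are $A,B,\widetilde A,\widetilde B>0$ such that, for all $f\in L_2(\mathbb R^d)$, $$A\|f\|^2\le\sum_{j,k,\nu}|\langle f,\psi^{(\nu)}_{jk}\rangle|^2\le B\|f\|^2,\qquad \widetilde A\|f\|^2\le\sum_{j,k,\nu}|\langle f,\widetilde\psi^{(\nu)}_{jk}\rangle|^2\le\widetilde B\|f\|^2,$$ and $f=\sum_{j\in\mathbb Z}\sum_{k\in\mathbb Z^d}\sum_{\nu=1}^r\langle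 f,\widetilde\psi^{(\nu)}_{jk}\rangle\psi^{(\nu)}_{jk}$ in $L_2(\mathbb R^d)$. Let $n\ge 1$ be an integer and suppose that for some $C_1$ and some $\gamma>n+d$, for all $\nu=1,\dots,r$ and almost all $x\in\mathbb R^d$, $$|\psi^{(\nu)}(x)|,\ |\widetilde\psi^{(\nu)}(x)|\le\frac{C_1}{(1+|x|)^{\gamma}},$$ and that $\{\widetilde\psi^{(\nu)}_{jk}\}$ has the $VM^{n-1}$ property, i.e. $D^\beta\widehat{\widetilde\psi^{(\nu)}}(\mathbf 0)=0$ for all $\nu$ and all multi-indices $\beta$ with $\beta_1+\dots+\beta_d\le n-1$. Then the frame decomposition has approximation order $n$: there exist $C>0$ and $\lambda>1$ such that for every $f$ in the Sobolev space $W_2^n(\mathbb R^d)$ and every $j\in\mathbb Z$ $$\Bigl\|f-\sum_{i<j}\sum_{k\in\mathbb Z^d}\sum_{\nu=1}^r\langle f,\widetilde\psi^{(\nu)}_{ik}\rangle\psi^{(\nu)}_{ik}\Bigr\|_2\le C\,\frac{\|f\|_{W_2^n}}{\lambda^{jn}},\qquad(*)$$ where $\|f\|_{W_2^n}^2=\sum_{\alpha_1+\dots+\alpha_d\le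 n}\|D^\alpha f\|_2^2$. Moreover, for every $\lambda>1$ that is less than the minimal modulus of an eigenvalue of $M$ there is $C>0$ such that $(*)$ holds for all $f\in W_2^n(\mathbb R^d)$ and $j\in\mathbb Z$; and if $M=cI_d$, then this is so with $\lambda=|c|$. -/

import Mathlib

namespace WaveletFrame

open MeasureTheory

open scoped FourierTransform

noncomputable section

/-- Euclidean space of dimension `d`. -/
abbrev Space (d : ℕ) : Type := EuclideanSpace ℝ (Fin d)

/-- The complex Hilbert space of square-integrable functions (Lebesgue measure). -/
abbrev L2 (d : ℕ) : Type := Lp ℂ 2 (volume : Measure (Space d))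

/-- A dilation matrix: a nondegenerate integer matrix all of whose complex eigenvalues are bigger
than `1` in modulus. -/
structure IsDilationMatrix {d : ℕ} (M : Matrix (Fin d) (Fin d) ℤ) : Prop where
  det_ne_zero : M.det ≠ 0
  one_lt_norm : ∀ z ∈ spectrum ℂ (M.map (Int.cast : ℤ → ℂ)), 1 < ‖z‖

/-- The function `x ↦ m ^ (j / 2) * ψ (M ^ j x + k)`, where `m = |det M|`. -/
def dilateTranslate {d : ℕ} (M : Matrix (Fin d) (Fin d) ℤ) (ψ : Space d → ℂ)
    (j : ℤ) (k : Fin d → ℤ) : Space d → ℂ :=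
  fun x ↦ ((|(M.det : ℝ)| ^ ((j : ℝ) / 2) : ℝ) : ℂ) *
    ψ (Matrix.toEuclideanLin ((M.map (Int.cast : ℤ → ℝ)) ^ j) x +
      WithLp.toLp 2 (fun i ↦ (k i : ℝ)))

theorem memLp_dilateTranslate {d : ℕ} {M : Matrix (Fin d) (Fin d) ℤ} (hM : M.det ≠ 0)
    {ψ : Space d → ℂ} (hψ : MemLp ψ 2 volume) (j : ℤ) (k : Fin d → ℤ) :
    MemLp (dilateTranslate M ψ j k) 2 volume := by
  refine MemLp.const_mul ?_ _
  set b : Space d := WithLp.toLp 2 (fun i ↦ (k i : ℝ))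
  set L : Space d →ₗ[ℝ] Space d :=
    Matrix.toEuclideanLin ((M.map (Int.cast : ℤ → ℝ)) ^ j) with hL
  have hdet : LinearMap.det L ≠ 0 := by
    rw [hL, LinearMap.det_toLpLin]
    refine IsUnit.ne_zero (IsUnit.det_zpow ?_ j)
    have h : (M.map (Int.cast : ℤ → ℝ)).det = (M.det : ℝ) :=
      (RingHom.map_det (Int.castRingHom ℝ) M).symm
    rw [h, isUnit_iff_ne_zero]
    exact_mod_cast hM
  have h1 : MemLp (fun y ↦ ψ (y + b)) 2 volume :=
    hψ.comp_measurePreserving (measurePreserving_add_right volume b)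
  have hmeas : Measurable L := (LinearMap.continuous_of_finiteDimensional L).measurable
  have h2 : MemLp (fun y ↦ ψ (y + b)) 2 (Measure.map L volume) := by
    rw [Measure.map_linearMap_addHaar_eq_smul_addHaar volume hdet]
    exact h1.smul_measure ENNReal.ofReal_ne_top
  exact h2.comp_of_map hmeas.aemeasurable

/-- The element `ψ_{jk} = m ^ (j / 2) ψ (M ^ j · + k)` of the wavelet system generated by `ψ`. -/
def wavelet {d : ℕ} {M : Matrix (Fin d) (Fin d) ℤ} (hM : IsDilationMatrix M) (ψ : L2 d)
    (j : ℤ) (k : Fin d → ℤ) : L2 d :=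
  (memLp_dilateTranslate hM.det_ne_zero (Lp.memLp ψ) j k).toLp
    (dilateTranslate M (fun x ↦ ψ x) j k)

/-- The wavelet system generated by `ψ 0, …, ψ (r - 1)` is a frame. -/
def IsFrame {d r : ℕ} {M : Matrix (Fin d) (Fin d) ℤ} (hM : IsDilationMatrix M)
    (ψ : Fin r → L2 d) : Prop :=
  ∃ A B : ℝ, 0 < A ∧ 0 < B ∧ ∀ f : L2 d, ∃ s : ℝ,
    HasSum (fun p : ℤ × (Fin d → ℤ) × Fin r ↦
      ‖inner ℂ (wavelet hM (ψ p.2.2) p.1 p.2.1) f‖ ^ 2) s ∧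
    A * ‖f‖ ^ 2 ≤ s ∧ s ≤ B * ‖f‖ ^ 2

/-- The term `⟨f, ψ'_{jk}⟩ ψ_{jk}` of the frame expansion of `f`. Mathlib's inner product is
conjugate-linear in the first argument, so `inner ℂ g f` is the integral of `f` times the conjugate
of `g`. -/
def expansionTerm {d : ℕ} {M : Matrix (Fin d) (Fin d) ℤ} (hM : IsDilationMatrix M)
    (ψ ψ' : L2 d) (f : L2 d) (j : ℤ) (k : Fin d → ℤ) : L2 d :=
  inner ℂ (wavelet hM ψ' j k) f • wavelet hM ψ j k

/-- The wavelet systems generated by `ψ` and `ψ'` are dual frames: both are frames, and every `f`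
is the sum of its frame expansion. -/
structure AreDualFrames {d r : ℕ} {M : Matrix (Fin d) (Fin d) ℤ} (hM : IsDilationMatrix M)
    (ψ ψ' : Fin r → L2 d) : Prop where
  frame : IsFrame hM ψ
  dual_frame : IsFrame hM ψ'
  expansion : ∀ f : L2 d, HasSum (fun p : ℤ × (Fin d → ℤ) × Fin r ↦
    expansionTerm hM (ψ p.2.2) (ψ' p.2.2) f p.1 p.2.1) f

/-- The list of coordinate directions belonging to a multi-index `α`: the basis vector `e i` occurs
`α i` times. -/
def multiIndexDirections {d : ℕ} (α : Fin d → ℕ) : Fin (∑ i, α i) → Space d :=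
  fun l ↦ EuclideanSpace.single (finSigmaFinEquiv.symm l).1 (1 : ℝ)

/-- The partial derivative `D ^ α g` at the point `x`. -/
def multiDeriv {d : ℕ} (α : Fin d → ℕ) (g : Space d → ℂ) (x : Space d) : ℂ :=
  iteratedFDeriv ℝ (∑ i, α i) g x (multiIndexDirections α)

/-- The wavelet system generated by `ψ` has vanishing moments up to order `n`: all partial
derivatives of order at most `n` of the Fourier transforms of the generators vanish at the origin.
The first two clauses say that the Fourier transforms are given by the Fourier integral and have
the derivatives in question. -/
def HasVanishingMoments {d r : ℕ} (n : ℕ) (ψ : Fin r → L2 d) : Prop :=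
  ∀ ν, Integrable (fun x ↦ ψ ν x) volume ∧
    ContDiffAt ℝ n (𝓕 (fun x ↦ ψ ν x) : Space d → ℂ) 0 ∧
    ∀ β : Fin d → ℕ, ∑ i, β i ≤ n →
      multiDeriv β (𝓕 (fun x ↦ ψ ν x) : Space d → ℂ) 0 = 0

/-- `g` is the distributional derivative `D ^ α f`. -/
def IsWeakDeriv {d : ℕ} (α : Fin d → ℕ) (f g : L2 d) : Prop :=
  LineDeriv.iteratedLineDerivOp (multiIndexDirections α) (Lp.toTemperedDistribution f) =
    Lp.toTemperedDistribution g

/-- Membership in the Sobolev space `W_2^n`: all distributional derivatives of order at most `n`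
are square-integrable functions. -/
def MemW {d : ℕ} (n : ℕ) (f : L2 d) : Prop :=
  ∀ α : Fin d → ℕ, ∑ i, α i ≤ n → ∃ g : L2 d, IsWeakDeriv α f g

open scoped Classical in
/-- The distributional derivative `D ^ α f`, when it is a square-integrable function. -/
def weakDeriv {d : ℕ} (α : Fin d → ℕ) (f : L2 d) : L2 d :=
  if h : ∃ g : L2 d, IsWeakDeriv α f g then h.choose else 0

/-- The norm of `W_2^n`: the square root of the sum of `‖D ^ α f‖ ^ 2` over the multi-indices `α`
of order at most `n`. -/
def sobolevNorm {d : ℕ} (n : ℕ) (f : L2 d) : ℝ :=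
  √(∑ l ∈ Finset.range (n + 1), ∑ α ∈ Finset.piAntidiag (Finset.univ : Finset (Fin d)) l,
    ‖weakDeriv α f‖ ^ 2)

/-- The frame expansion approximates functions of `W_2^n` at the rate `lam ^ (-j n)`: there is
`C > 0` such that for each `f` in `W_2^n` and each `j` the sum of the terms with scale `i < j` (all
translations, all generators) converges and differs from `f` by at most `C ‖f‖ / lam ^ (j n)`. -/
def ApproximatesAtRate {d r : ℕ} {M : Matrix (Fin d) (Fin d) ℤ} (hM : IsDilationMatrix M)
    (ψ ψ' : Fin r → L2 d) (n : ℕ) (lam : ℝ) : Prop :=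
  ∃ C : ℝ, 0 < C ∧ ∀ f : L2 d, MemW n f → ∀ j : ℤ, ∃ S : L2 d,
    HasSum (fun p : Set.Iio j × (Fin d → ℤ) × Fin r ↦
      expansionTerm hM (ψ p.2.2) (ψ' p.2.2) f p.1 p.2.1) S ∧
    ‖f - S‖ ≤ C * sobolevNorm n f / lam ^ (j * (n : ℤ))

/-- The frame expansion has approximation order `n`: the rate above holds for some `lam > 1`. -/
def HasApproximationOrder {d r : ℕ} {M : Matrix (Fin d) (Fin d) ℤ} (hM : IsDilationMatrix M)
    (ψ ψ' : Fin r → L2 d) (n : ℕ) : Prop :=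
  ∃ lam : ℝ, 1 < lam ∧ ApproximatesAtRate hM ψ ψ' n lam

end

end WaveletFrame

/-! ### Vanishing moments and the order of the zero of the Fourier transform at the origin. -/

namespace WaveletFrame
open MeasureTheory Complex
open scoped FourierTransform Real InnerProductSpace

/-! The error `f - S` is the part of the frame expansion with scales `i ≥ j`. By duality the upper
frame bound of `ψ` controls its squared norm by the sum of the squared coefficients at those scales
(`norm_sq_le_of_hasSum_smul`), so it suffices to bound the coefficients scale by scale.

Let `L = M ^ i`, let `N` be the operator norm of `L⁻¹`, and cut the Fourier transform of `f` off to
the set of `ξ` that the inverse adjoint of `L` sends into the unit cube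
(`exists_lowFrequency_part`). Off this set `1 ≤ 2 N ‖ξ‖`, so the high-frequency part has squared
norm at most `4 ^ n N ^ (2n) ∫ ‖ξ‖ ^ (2n) ‖𝓕 f‖ ^ 2`, and the upper frame bound of `ψ'` handles its
coefficients. On this set the coefficients of one generator are Fourier coefficients with respect to
an orthonormal system of dilated exponentials, and Bessel's inequality applies. Decay and vanishing
moments give `‖𝓕 ψ' η‖ ≤ C ‖η‖ ^ n` (`norm_fourier_le_of_multiDeriv_eq_zero`), which again yields
the factor `N ^ (2n)`. The weighted integral is bounded by the Sobolev norm through Plancherel.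

Gelfand's formula for the inverse matrix gives `N ≤ K / lam ^ i` for `i ≥ 0` whenever `lam` lies
below all moduli of eigenvalues, and the sum over the scales is a geometric series
(`approximatesAtRate_of_norm_le`). For scalar `M` the bound on `N` is explicit and reaches the
endpoint `lam = |c|`. -/

/-- The Taylor remainder of the exponential on the imaginary axis. -/
theorem norm_exp_sub_sum_le_of_re_eq_zero {z : ℂ} (hz : z.re = 0) (n : ℕ) :
    ‖exp z - ∑ l ∈ Finset.range n, z ^ l / (l.factorial : ℂ)‖ ≤ (n + 3) * ‖z‖ ^ n := by
  -- The constant covers both cases: `e < 3` for small `z`, and for large `z` the exponential and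
  -- each of the `n` Taylor terms are at most `‖z‖ ^ n`.
  rcases le_or_gt ‖z‖ 1 with h | h
  · refine (norm_exp_sub_sum_le_norm_mul_exp z n).trans ?_
    have h3 : Real.exp ‖z‖ ≤ n + 3 := by
      have h1 := Real.exp_le_exp.2 h
      have := Real.exp_one_lt_d9
      have h4 : (0 : ℝ) ≤ n := Nat.cast_nonneg n
      linarith
    rw [mul_comm]
    gcongr
  · have h1 : ‖exp z‖ = 1 := by rw [norm_exp, hz, Real.exp_zero]
    have h2 : ‖∑ l ∈ Finset.range n, z ^ l / (l.factorial : ℂ)‖ ≤ n * ‖z‖ ^ n := by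
      refine (norm_sum_le _ _).trans ?_
      have : ∀ l ∈ Finset.range n, ‖z ^ l / (l.factorial : ℂ)‖ ≤ ‖z‖ ^ n := by
        intro l hl
        rw [norm_div, norm_pow, norm_natCast]
        refine (div_le_self (by positivity) ?_).trans
          (pow_le_pow_right₀ h.le (Finset.mem_range.1 hl).le)
        exact_mod_cast Nat.factorial_pos l
      refine (Finset.sum_le_sum this).trans ?_
      simp
    have h3 : 1 ≤ ‖z‖ ^ n := one_le_pow₀ h.le
    refine (norm_sub_le _ _).trans ?_
    rw [h1]
    nlinarith

/-- Turns the list of directions into a monomial with exponent `α`; used for classical derivatives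
of the Fourier integral and for weak derivatives. -/
theorem prod_multiIndexDirections {d : ℕ} {R : Type*} [CommMonoid R] (α : Fin d → ℕ)
    (F : Space d → R) :
    ∏ l, F (multiIndexDirections α l) = ∏ i, F (EuclideanSpace.single i 1) ^ α i := by
  unfold multiIndexDirections
  rw [finSigmaFinEquiv.symm.prod_comp (fun s : (Σ i : Fin d, Fin (α i)) ↦
    F (EuclideanSpace.single s.1 (1 : ℝ))), Fintype.prod_sigma]
  simp

/-- The derivatives of the Fourier transform at the origin are the moments. -/
theorem multiDeriv_fourier_zero {d n : ℕ} {g : Space d → ℂ}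
    (hg : ∀ l ≤ n, Integrable (fun x ↦ ‖x‖ ^ l * ‖g x‖)) (hm : AEStronglyMeasurable g)
    {α : Fin d → ℕ} (hα : ∑ i, α i ≤ n) :
    multiDeriv α (𝓕 g) 0 = (-(2 * π * I)) ^ (∑ i, α i) *
      ∫ x, ((∏ i, x i ^ α i : ℝ) : ℂ) * g x := by
  unfold multiDeriv
  rw [Real.iteratedFDeriv_fourier (N := (n : ℕ∞)) (fun l hl ↦ hg l (by exact_mod_cast hl)) hm
    (by exact_mod_cast hα), Real.fourier_eq]
  simp only [inner_zero_right, neg_zero, AddChar.map_zero_eq_one, one_smul]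
  rw [ContinuousMultilinearMap.integral_apply]
  swap
  · exact VectorFourier.integrable_fourierPowSMulRight _ (hg _ hα) hm
  rw [← integral_const_mul]
  congr 1 with x
  simp only [VectorFourier.fourierPowSMulRight_apply, smul_eq_mul]
  rw [prod_multiIndexDirections α (fun v ↦ innerSL ℝ x v)]
  simp [EuclideanSpace.inner_single_right]

/-- Vanishing moments give a zero of the Fourier transform at the origin. -/
theorem norm_fourier_le_of_multiDeriv_eq_zero {d n : ℕ} {g : Space d → ℂ}
    (hg : ∀ l ≤ n, Integrable (fun x ↦ ‖x‖ ^ l * ‖g x‖)) (hm : AEStronglyMeasurable g)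
    (h0 : ∀ α : Fin d → ℕ, ∑ i, α i < n → multiDeriv α (𝓕 g) 0 = 0) :
    ∃ C : ℝ, 0 ≤ C ∧ ∀ η, ‖𝓕 g η‖ ≤ C * ‖η‖ ^ n := by
  have hint : Integrable g := by
    have := hg 0 n.zero_le
    simp only [pow_zero, one_mul] at this
    exact (integrable_norm_iff hm).1 this
  have hmom : ∀ α : Fin d → ℕ, ∑ i, α i < n → ∫ x, ((∏ i, x i ^ α i : ℝ) : ℂ) * g x = 0 := by
    intro α hα
    have h := multiDeriv_fourier_zero hg hm hα.le
    rw [h0 α hα] at h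
    have h2 : (-(2 * π * I)) ^ (∑ i, α i) ≠ 0 := by
      apply pow_ne_zero
      simp [Real.pi_ne_zero]
    exact (mul_eq_zero.1 h.symm).resolve_left h2
  have hmon : ∀ α : Fin d → ℕ, ∑ i, α i ≤ n →
      Integrable (fun x : Space d ↦ ((∏ i, x i ^ α i : ℝ) : ℂ) * g x) := by
    intro α hα
    refine (hg _ hα).mono' ?_ (Filter.Eventually.of_forall fun x ↦ ?_)
    · refine AEStronglyMeasurable.mul (Continuous.aestronglyMeasurable ?_) hm
      fun_prop
    · rw [norm_mul, norm_real, Finset.prod_pow_eq_pow_sum Finset.univ α ‖x‖ |>.symm, norm_prod]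
      gcongr with i
      rw [norm_pow]
      gcongr
      exact PiLp.norm_apply_le x i
  -- The multinomial theorem reduces powers of the inner product to the monomial moments.
  have hexpand : ∀ (η x : Space d) (l : ℕ), (-(2 * π * I) * (⟪x, η⟫_ℝ : ℝ)) ^ l * g x =
      ∑ α ∈ Finset.piAntidiag (Finset.univ : Finset (Fin d)) l,
        ((-(2 * π * I)) ^ l * Nat.multinomial Finset.univ α * ((∏ i, η i ^ α i : ℝ) : ℂ)) *
          (((∏ i, x i ^ α i : ℝ) : ℂ) * g x) := by
    intro η x l
    have : ((⟪x, η⟫_ℝ : ℝ) : ℂ) = ∑ i, ((x i * η i : ℝ) : ℂ) := by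
      rw [PiLp.inner_apply]; push_cast
      simp [mul_comm]
    rw [mul_pow, this, Finset.sum_pow_eq_sum_piAntidiag, Finset.mul_sum, Finset.sum_mul]
    refine Finset.sum_congr rfl fun α _ ↦ ?_
    push_cast
    simp only [mul_pow, Finset.prod_mul_distrib]
    ring
  have hIl : ∀ (η : Space d) (l : ℕ), l ≤ n →
      Integrable (fun x ↦ (-(2 * π * I) * (⟪x, η⟫_ℝ : ℝ)) ^ l * g x) := by
    intro η l hl
    simp_rw [hexpand]
    refine integrable_finsetSum _ fun α hα ↦ (hmon α ?_).const_mul _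
    rw [Finset.mem_piAntidiag] at hα
    exact hα.1.trans_le hl
  have hI0 : ∀ (η : Space d) (l : ℕ), l < n →
      ∫ x, (-(2 * π * I) * (⟪x, η⟫_ℝ : ℝ)) ^ l * g x = 0 := by
    intro η l hl
    simp_rw [hexpand]
    rw [integral_finsetSum]
    · refine Finset.sum_eq_zero fun α hα ↦ ?_
      rw [Finset.mem_piAntidiag] at hα
      rw [integral_const_mul, hmom α (hα.1.trans_lt hl), mul_zero]
    · intro α hα
      rw [Finset.mem_piAntidiag] at hα
      exact (hmon α (hα.1.trans_le hl.le)).const_mul _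
  refine ⟨(n + 3) * (2 * π) ^ n * ∫ x, ‖x‖ ^ n * ‖g x‖, by positivity, fun η ↦ ?_⟩
  have hI : Integrable (fun x ↦ exp (-(2 * π * I) * (⟪x, η⟫_ℝ : ℝ)) * g x) := by
    refine hint.norm.mono' (AEStronglyMeasurable.mul (Continuous.aestronglyMeasurable ?_) hm)
      (Filter.Eventually.of_forall fun x ↦ ?_)
    · fun_prop
    · rw [norm_mul, norm_exp]
      simp
  -- Subtracting the Taylor polynomial of degree below `n` costs nothing, since the moments of those
  -- orders vanish.
  have hF : 𝓕 g η = ∫ x, (exp (-(2 * π * I) * (⟪x, η⟫_ℝ : ℝ)) -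
      ∑ l ∈ Finset.range n, (-(2 * π * I) * (⟪x, η⟫_ℝ : ℝ)) ^ l / (l.factorial : ℂ)) * g x := by
    simp_rw [sub_mul, Finset.sum_mul, div_mul_eq_mul_div]
    rw [integral_sub hI, integral_finsetSum]
    · rw [Finset.sum_eq_zero, sub_zero, Real.fourier_eq']
      · congr 1 with x
        rw [smul_eq_mul]
        congr 2
        push_cast
        ring
      · intro l hl
        rw [integral_div, hI0 η l (Finset.mem_range.1 hl), zero_div]
    · intro l hl
      exact (hIl η l (Finset.mem_range.1 hl).le).div_const _
    · refine integrable_finsetSum _ fun l hl ↦ ?_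
      exact (hIl η l (Finset.mem_range.1 hl).le).div_const _
  rw [hF]
  refine (norm_integral_le_of_norm_le
    (g := fun x ↦ ((n + 3) * (2 * π) ^ n * ‖η‖ ^ n) * (‖x‖ ^ n * ‖g x‖))
    ((hg n le_rfl).const_mul _) (Filter.Eventually.of_forall fun x ↦ ?_)).trans_eq ?_
  · rw [norm_mul]
    have hb : ‖-(2 * π * I) * ((⟪x, η⟫_ℝ : ℝ) : ℂ)‖ ≤ 2 * π * (‖x‖ * ‖η‖) := by
      rw [norm_mul, norm_real]
      have : ‖-(2 * π * I)‖ = 2 * π := by simp [abs_of_pos Real.pi_pos]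
      rw [this]
      gcongr
      exact norm_inner_le_norm x η
    calc _ ≤ (n + 3) * ‖-(2 * π * I) * ((⟪x, η⟫_ℝ : ℝ) : ℂ)‖ ^ n * ‖g x‖ := by
          gcongr
          exact norm_exp_sub_sum_le_of_re_eq_zero (by simp) n
      _ ≤ (n + 3) * (2 * π * (‖x‖ * ‖η‖)) ^ n * ‖g x‖ := by gcongr
      _ = _ := by rw [mul_pow, mul_pow]; ring
  · rw [integral_const_mul]; ring

/-- Polynomial decay gives moments. -/
theorem integrable_pow_mul_norm_of_decay {d n : ℕ} {g : Space d → ℂ} {C γ : ℝ}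
    (hγ : (n : ℝ) + d < γ) (hm : AEStronglyMeasurable g)
    (hg : ∀ᵐ x, ‖g x‖ ≤ C / (1 + ‖x‖) ^ γ) {l : ℕ} (hl : l ≤ n) :
    Integrable (fun x ↦ ‖x‖ ^ l * ‖g x‖) := by
  -- The weight `‖x‖ ^ n` uses up `n` of the decay, and the remaining exponent `γ - n` exceeds `d`.
  have h1 : Integrable (fun x : Space d ↦ |C| * (1 + ‖x‖) ^ (-(γ - n))) :=
    (integrable_one_add_norm (by simp; linarith)).const_mul _
  refine h1.mono' ((Continuous.aestronglyMeasurable (by fun_prop)).mul hm.norm) ?_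
  filter_upwards [hg] with x hx
  have h0 : 0 < 1 + ‖x‖ := by positivity
  rw [norm_mul, norm_norm, norm_pow, norm_norm]
  calc ‖x‖ ^ l * ‖g x‖ ≤ (1 + ‖x‖) ^ n * (|C| / (1 + ‖x‖) ^ γ) := by
        gcongr ?_ * ?_
        · calc ‖x‖ ^ l ≤ (1 + ‖x‖) ^ l := by gcongr; linarith
            _ ≤ _ := pow_le_pow_right₀ (by linarith [norm_nonneg x]) hl
        · refine hx.trans ?_
          gcongr
          exact le_abs_self C
    _ = _ := by
        rw [neg_sub, Real.rpow_sub h0, Real.rpow_natCast]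
        ring
end WaveletFrame

/-! ### Weak derivatives, Sobolev norms and the `L²` Fourier transform. -/

namespace WaveletFrame
open MeasureTheory Complex
open scoped FourierTransform Real InnerProductSpace SchwartzMap ContDiff LineDeriv

/-- Locally integrable functions that agree as tempered distributions agree almost everywhere. -/
theorem ae_eq_of_integral_schwartz_smul_eq {d : ℕ} {f g : Space d → ℂ}
    (hf : LocallyIntegrable f) (hg : LocallyIntegrable g)
    (h : ∀ u : 𝓢(Space d, ℂ), ∫ x, u x * f x = ∫ x, u x * g x) : f =ᵐ[volume] g := by
  refine ae_eq_of_integral_contDiff_smul_eq hf hg fun u hu hc ↦ ?_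
  have hg₁ : HasCompactSupport (ofRealCLM ∘ u) := hc.comp_left rfl
  have hg₂ : ContDiff ℝ ∞ (ofRealCLM ∘ u) := by fun_prop
  simpa using h (hg₁.toSchwartzMap hg₂)

/-- Each derivative becomes multiplication by `2πi⟪x, m l⟫` on the Fourier side, which duality moves
onto the test function. Only the pointwise values of the new test function `v` matter later. -/
theorem fourier_iteratedLineDerivOp_apply {d : ℕ} (T : 𝓢'(Space d, ℂ)) :
    ∀ (k : ℕ) (m : Fin k → Space d) (u : 𝓢(Space d, ℂ)), ∃ v : 𝓢(Space d, ℂ),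
      (∀ x, v x = (2 * π * I) ^ k * (∏ l, ((⟪x, m l⟫_ℝ : ℝ) : ℂ)) * u x) ∧
      𝓕 (∂^{m} T) u = 𝓕 T v := by
  intro k
  induction k with
  | zero => intro m u; exact ⟨u, by simp, by simp⟩
  | succ k ih =>
    intro m u
    have ht : (fun x : Space d ↦ ((⟪x, m 0⟫_ℝ : ℝ) : ℂ)).HasTemperateGrowth := by fun_prop
    obtain ⟨v, hv, hv2⟩ := ih (Fin.tail m) ((2 * π * I) •
      SchwartzMap.smulLeftCLM ℂ (fun x : Space d ↦ ((⟪x, m 0⟫_ℝ : ℝ) : ℂ)) u)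
    refine ⟨v, fun x ↦ ?_, ?_⟩
    · rw [hv x, Fin.prod_univ_succ]
      simp only [smul_apply, smul_eq_mul, Fin.tail,
        SchwartzMap.smulLeftCLM_apply_apply ht]
      ring
    · rw [LineDeriv.iteratedLineDerivOp_succ_left, TemperedDistribution.fourier_lineDerivOp_eq,
        ← hv2]
      simp

/-- On the Fourier side a weak derivative is multiplication by a monomial. -/
theorem IsWeakDeriv.fourier_ae_eq {d : ℕ} {α : Fin d → ℕ} {f g : L2 d} (h : IsWeakDeriv α f g) :
    (fun ξ ↦ (𝓕 g : L2 d) ξ) =ᵐ[volume] fun ξ ↦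
      (2 * π * I) ^ (∑ i, α i) * ((∏ i, ξ i ^ α i : ℝ) : ℂ) * (𝓕 f : L2 d) ξ := by
  have hl : ∀ w : L2 d, LocallyIntegrable (fun ξ ↦ w ξ) := fun w ↦
    (Lp.memLp w).locallyIntegrable one_le_two
  refine ae_eq_of_integral_schwartz_smul_eq (hl _) ?_ fun u ↦ ?_
  · refine ((hl _).continuous_mul ?_)
    fun_prop
  · obtain ⟨v, hv, hv2⟩ := fourier_iteratedLineDerivOp_apply (Lp.toTemperedDistribution f) _
      (multiIndexDirections α) u
    rw [IsWeakDeriv] at h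
    rw [h, Lp.fourier_toTemperedDistribution_eq, Lp.fourier_toTemperedDistribution_eq,
      Lp.toTemperedDistribution_apply, Lp.toTemperedDistribution_apply] at hv2
    simp only [smul_eq_mul] at hv2
    rw [hv2]
    congr 1 with x
    rw [hv x, prod_multiIndexDirections α (fun m ↦ ((⟪x, m⟫_ℝ : ℝ) : ℂ))]
    simp only [EuclideanSpace.inner_single_right]
    push_cast
    simp only [one_mul, conj_trivial]
    ring

theorem isWeakDeriv_weakDeriv {d n : ℕ} {f : L2 d} (hf : MemW n f) {α : Fin d → ℕ}
    (hα : ∑ i, α i ≤ n) : IsWeakDeriv α f (weakDeriv α f) := by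
  rw [weakDeriv, dif_pos (hf α hα)]
  exact (hf α hα).choose_spec

theorem integrable_norm_sq {d : ℕ} (f : L2 d) : Integrable (fun x ↦ ‖f x‖ ^ 2) :=
  (Lp.memLp f).integrable_norm_pow two_ne_zero

theorem norm_sq_eq_integral {d : ℕ} (f : L2 d) : ‖f‖ ^ 2 = ∫ x, ‖f x‖ ^ 2 := by
  have h := L2.inner_def (𝕜 := ℂ) f f
  rw [inner_self_eq_norm_sq_to_K] at h
  have h2 : ∫ x, (inner ℂ (f x) (f x) : ℂ) = ((∫ x, ‖f x‖ ^ 2 : ℝ) : ℂ) := by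
    rw [← integral_complex_ofReal]
    congr 1 with x
    rw [inner_self_eq_norm_sq_to_K]
    simp
  rw [h2] at h
  refine Complex.ofReal_injective ?_
  rw [Complex.ofReal_pow]
  exact h

theorem IsWeakDeriv.norm_sq_ae_eq {d : ℕ} {α : Fin d → ℕ} {f g : L2 d} (h : IsWeakDeriv α f g) :
    (fun ξ ↦ ‖(𝓕 g : L2 d) ξ‖ ^ 2) =ᵐ[volume] fun ξ ↦
      (2 * π) ^ (2 * ∑ i, α i) * ((∏ i, (ξ i ^ 2) ^ α i) * ‖(𝓕 f : L2 d) ξ‖ ^ 2) := by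
  filter_upwards [h.fourier_ae_eq] with ξ hξ
  have h1 : ‖((∏ i, ξ i ^ α i : ℝ) : ℂ)‖ ^ 2 = ∏ i, (ξ i ^ 2) ^ α i := by
    rw [norm_real, Real.norm_eq_abs, sq_abs, ← Finset.prod_pow]
    exact Finset.prod_congr rfl fun i _ ↦ by ring
  have h2 : ‖(2 * π * I : ℂ)‖ = 2 * π := by simp [abs_of_pos Real.pi_pos]
  rw [hξ, norm_mul, norm_mul, norm_pow, mul_pow, mul_pow, h1, h2]
  ring

/-- The homogeneous Sobolev seminorm on the Fourier side is bounded by the Sobolev norm. -/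
theorem MemW.integral_fourier_le {d n : ℕ} {f : L2 d} (hf : MemW n f) :
    Integrable (fun ξ ↦ ‖ξ‖ ^ (2 * n) * ‖(𝓕 f : L2 d) ξ‖ ^ 2) ∧
      ∫ ξ, ‖ξ‖ ^ (2 * n) * ‖(𝓕 f : L2 d) ξ‖ ^ 2 ≤ n.factorial * sobolevNorm n f ^ 2 := by
  set P := Finset.piAntidiag (Finset.univ : Finset (Fin d)) n with hP
  have hsum : ∀ α ∈ P, ∑ i, α i = n := fun α hα ↦ (Finset.mem_piAntidiag.1 hα).1
  have key : ∀ α ∈ P, Integrable (fun ξ : Space d ↦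
        (∏ i, (ξ i ^ 2) ^ α i) * ‖(𝓕 f : L2 d) ξ‖ ^ 2) ∧
      ∫ ξ : Space d, (∏ i, (ξ i ^ 2) ^ α i) * ‖(𝓕 f : L2 d) ξ‖ ^ 2 ≤ ‖weakDeriv α f‖ ^ 2 := by
    intro α hα
    have hw := (isWeakDeriv_weakDeriv hf (hsum α hα).le).norm_sq_ae_eq
    -- The factor produced by differentiation is at least `1`, so it may be dropped in the upper
    -- bound.
    have hc : 1 ≤ (2 * π) ^ (2 * ∑ i, α i) := one_le_pow₀ (by linarith [Real.pi_gt_three])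
    have hc0 : (2 * π) ^ (2 * ∑ i, α i) ≠ 0 := by positivity
    constructor
    · have := ((integrable_norm_sq (𝓕 (weakDeriv α f) : L2 d)).congr hw).const_mul
        ((2 * π) ^ (2 * ∑ i, α i))⁻¹
      refine this.congr (Filter.Eventually.of_forall fun ξ ↦ ?_)
      simp only
      rw [inv_mul_cancel_left₀ hc0]
    · rw [← Lp.norm_fourier_eq, norm_sq_eq_integral, integral_congr_ae hw, integral_const_mul]
      refine le_mul_of_one_le_left (integral_nonneg fun ξ ↦ ?_) hc
      positivity
  -- Multinomial expansion of `(∑ ξ i ^ 2) ^ n`; its coefficients are at most `n!`, the constant in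
  -- the conclusion.
  have hexp : ∀ ξ : Space d, ‖ξ‖ ^ (2 * n) * ‖(𝓕 f : L2 d) ξ‖ ^ 2 =
      ∑ α ∈ P, (Nat.multinomial Finset.univ α : ℝ) *
        ((∏ i, (ξ i ^ 2) ^ α i) * ‖(𝓕 f : L2 d) ξ‖ ^ 2) := by
    intro ξ
    rw [pow_mul, EuclideanSpace.real_norm_sq_eq, Finset.sum_pow_eq_sum_piAntidiag, Finset.sum_mul]
    exact Finset.sum_congr rfl fun α _ ↦ by ring
  simp_rw [hexp]
  constructor
  · exact integrable_finsetSum _ fun α hα ↦ (key α hα).1.const_mul _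
  · rw [integral_finsetSum _ fun α hα ↦ (key α hα).1.const_mul _]
    calc _ ≤ ∑ α ∈ P, (n.factorial : ℝ) * ‖weakDeriv α f‖ ^ 2 := by
          refine Finset.sum_le_sum fun α hα ↦ ?_
          rw [integral_const_mul]
          gcongr
          · rw [Nat.multinomial, hsum α hα]
            exact Nat.div_le_self _ _
          · exact (key α hα).2
      _ ≤ _ := by
          rw [← Finset.mul_sum, sobolevNorm, Real.sq_sqrt (by positivity)]
          gcongr
          exact Finset.single_le_sum (f := fun l ↦ ∑ α ∈ Finset.piAntidiag
            (Finset.univ : Finset (Fin d)) l, ‖weakDeriv α f‖ ^ 2)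
            (fun l _ ↦ by positivity) (Finset.self_mem_range_succ n)

/-- The multi-index `0` contributes exactly `‖f‖ ^ 2`, by Plancherel. This bound settles negative
`j`. -/
theorem MemW.norm_le_sobolevNorm {d n : ℕ} {f : L2 d} (hf : MemW n f) :
    ‖f‖ ≤ sobolevNorm n f := by
  have h0 : ∑ i, (0 : Fin d → ℕ) i ≤ n := by simp
  have h := (isWeakDeriv_weakDeriv hf h0).norm_sq_ae_eq
  simp only [Pi.zero_apply, Finset.sum_const_zero, mul_zero, pow_zero, Finset.prod_const_one,
    one_mul] at h
  have h1 : ‖weakDeriv 0 f‖ ^ 2 = ‖f‖ ^ 2 := by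
    rw [← Lp.norm_fourier_eq, norm_sq_eq_integral, ← Lp.norm_fourier_eq f, norm_sq_eq_integral,
      integral_congr_ae h]
  refine Real.le_sqrt_of_sq_le ?_
  rw [← h1]
  have h2 : ∀ w : (Fin d → ℕ) → ℝ, (∀ α, 0 ≤ w α) → w 0 ≤ ∑ l ∈ Finset.range (n + 1),
      ∑ α ∈ Finset.piAntidiag (Finset.univ : Finset (Fin d)) l, w α := by
    intro w hw
    rw [Finset.sum_range_succ']
    simp only [Finset.piAntidiag_zero, Finset.sum_singleton]
    exact le_add_of_nonneg_left (Finset.sum_nonneg fun l _ ↦ Finset.sum_nonneg fun α _ ↦ hw α)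
  exact h2 (fun α ↦ ‖weakDeriv α f‖ ^ 2) fun α ↦ by positivity

/-- On integrable functions the `L²` Fourier transform is the Fourier integral. -/
theorem fourier_ae_eq_of_integrable {d : ℕ} (f : L2 d) {g : Space d → ℂ}
    (hfg : (fun x ↦ f x) =ᵐ[volume] g) (hg : Integrable g) :
    (fun ξ ↦ (𝓕 f : L2 d) ξ) =ᵐ[volume] 𝓕 g := by
  have hc : Continuous (𝓕 g) := VectorFourier.fourierIntegral_continuous
    Real.continuous_fourierChar (L := innerₗ (Space d)) continuous_inner hg
  refine ae_eq_of_integral_schwartz_smul_eq ((Lp.memLp _).locallyIntegrable one_le_two)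
    hc.locallyIntegrable fun u ↦ ?_
  have h := DFunLike.congr_fun (Lp.fourier_toTemperedDistribution_eq f) u
  rw [TemperedDistribution.fourier_apply, Lp.toTemperedDistribution_apply,
    Lp.toTemperedDistribution_apply] at h
  simp only [smul_eq_mul] at h
  rw [← h]
  have h2 : ∫ x, (𝓕 u : 𝓢(Space d, ℂ)) x * f x = ∫ x, (𝓕 u : 𝓢(Space d, ℂ)) x * g x :=
    integral_congr_ae (by filter_upwards [hfg] with x hx; rw [hx])
  rw [h2]
  simpa [SchwartzMap.fourier_coe] using! VectorFourier.integral_fourierIntegral_smul_eq_flip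
    (L := innerₗ (Space d)) Real.continuous_fourierChar continuous_inner
    (u.integrable (μ := volume)) hg
end WaveletFrame

/-! ### Affine changes of variables and Bessel's inequality on dilated cubes. -/

namespace WaveletFrame
open MeasureTheory Complex
open scoped FourierTransform Real InnerProductSpace ComplexConjugate

theorem map_continuousLinearEquiv_volume {d : ℕ} (L : Space d ≃L[ℝ] Space d) :
    Measure.map L (volume : Measure (Space d)) =
      ENNReal.ofReal |(LinearMap.det (L : Space d →ₗ[ℝ] Space d))⁻¹| • volume :=
  Measure.map_linearMap_addHaar_eq_smul_addHaar volume
    (LinearEquiv.isUnit_det' L.toLinearEquiv).ne_zero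

theorem integral_comp_continuousLinearEquiv {d : ℕ} {F : Type*} [NormedAddCommGroup F]
    [NormedSpace ℝ F] (L : Space d ≃L[ℝ] Space d) (H : Space d → F) :
    ∫ x, H (L x) = |LinearMap.det (L : Space d →ₗ[ℝ] Space d)|⁻¹ • ∫ y, H y := by
  have h := L.toHomeomorph.toMeasurableEquiv.measurableEmbedding.integral_map
    (μ := (volume : Measure (Space d))) H
  have h2 : (L.toHomeomorph.toMeasurableEquiv : Space d → Space d) = L := rfl
  rw [h2, map_continuousLinearEquiv_volume, integral_smul_measure,
    ENNReal.toReal_ofReal (abs_nonneg _), abs_inv] at h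
  exact h.symm

theorem memLp_comp_continuousLinearEquiv {d : ℕ} (L : Space d ≃L[ℝ] Space d) {g : Space d → ℂ}
    {p : ENNReal} (hg : MemLp g p) : MemLp (fun x ↦ g (L x)) p := by
  refine MemLp.comp_of_map (f := L) ?_ L.continuous.measurable.aemeasurable
  rw [map_continuousLinearEquiv_volume]
  exact hg.smul_measure ENNReal.ofReal_ne_top

/-- The Fourier transform of an affine change of variables. -/
theorem fourier_comp_affine {d : ℕ} (L : Space d ≃L[ℝ] Space d) (g : Space d → ℂ) (b ξ : Space d) :
    𝓕 (fun x ↦ g (L x + b)) ξ = ((|LinearMap.det (L : Space d →ₗ[ℝ] Space d)|⁻¹ : ℝ) : ℂ) *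
      (cexp (2 * π * I * (⟪b, (L.symm : Space d →L[ℝ] Space d).adjoint ξ⟫_ℝ : ℝ)) *
        𝓕 g ((L.symm : Space d →L[ℝ] Space d).adjoint ξ)) := by
  set η := (L.symm : Space d →L[ℝ] Space d).adjoint ξ with hη
  have hin : ∀ y, ⟪L.symm y, ξ⟫_ℝ = ⟪y, η⟫_ℝ := fun y ↦
    (ContinuousLinearMap.adjoint_inner_right (L.symm : Space d →L[ℝ] Space d) y ξ).symm
  rw [Real.fourier_eq']
  have h := integral_comp_continuousLinearEquiv L
    (fun y ↦ cexp (↑(-2 * π * ⟪L.symm y, ξ⟫_ℝ) * I) • g (y + b))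
  simp only [ContinuousLinearEquiv.symm_apply_apply] at h
  rw [h, Complex.real_smul]
  congr 1
  simp only [hin]
  have h2 := integral_add_right_eq_self (μ := (volume : Measure (Space d)))
    (fun y ↦ cexp (↑(-2 * π * ⟪y - b, η⟫_ℝ) * I) • g y) b
  simp only [add_sub_cancel_right] at h2
  rw [h2, Real.fourier_eq', ← integral_const_mul]
  congr 1 with y
  rw [smul_eq_mul, smul_eq_mul, ← mul_assoc, ← Complex.exp_add, inner_sub_left]
  congr 2
  push_cast
  ring

/-- The half-open unit cube centred at the origin. -/
def unitCube (d : ℕ) : Set (Space d) := {x | ∀ i, x i ∈ Set.Ico (-(1 / 2) : ℝ) (1 / 2)}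

theorem unitCube_eq_preimage (d : ℕ) : unitCube d = (MeasurableEquiv.toLp 2 (Fin d → ℝ)).symm ⁻¹'
    Set.univ.pi fun _ ↦ Set.Ico (-(1 / 2) : ℝ) (1 / 2) := by
  ext x; simp [unitCube]

theorem measurableSet_unitCube (d : ℕ) : MeasurableSet (unitCube d) := by
  rw [unitCube_eq_preimage]
  exact (MeasurableEquiv.measurable _) (MeasurableSet.univ_pi fun _ ↦ measurableSet_Ico)

theorem integral_unitCube {d : ℕ} (F : Fin d → ℝ → ℂ) :
    ∫ x in unitCube d, ∏ i, F i (x i) =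
      ∏ i, ∫ t in Set.Ico (-(1 / 2) : ℝ) (1 / 2), F i t := by
  rw [unitCube_eq_preimage]
  have h := (EuclideanSpace.volume_preserving_symm_measurableEquiv_toLp (Fin d)).setIntegral_preimage_emb
    (MeasurableEquiv.measurableEmbedding _) (fun x : Fin d → ℝ ↦ ∏ i, F i (x i))
    (Set.univ.pi fun _ ↦ Set.Ico (-(1 / 2) : ℝ) (1 / 2))
  refine Eq.trans h ?_
  rw [volume_pi, Measure.restrict_pi_pi, integral_fintype_prod_eq_prod]

theorem volume_unitCube_lt_top (d : ℕ) : volume (unitCube d) < ⊤ := by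
  rw [unitCube_eq_preimage,
    (EuclideanSpace.volume_preserving_symm_measurableEquiv_toLp (Fin d)).measure_preimage
    (MeasurableSet.univ_pi fun _ ↦ measurableSet_Ico).nullMeasurableSet, Real.volume_pi_Ico]
  exact ENNReal.prod_lt_top fun i _ ↦ ENNReal.ofReal_lt_top

theorem integral_exp_Ico (m : ℤ) :
    ∫ t in Set.Ico (-(1 / 2) : ℝ) (1 / 2), cexp (2 * π * I * m * t) = if m = 0 then 1 else 0 := by
  rw [integral_Ico_eq_integral_Ioc, ← intervalIntegral.integral_of_le (by norm_num)]
  split_ifs with h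
  · subst h
    simp only [Int.cast_zero, mul_zero, zero_mul, Complex.exp_zero, intervalIntegral.integral_const]
    norm_num
  · have hm : (2 * π * I * m : ℂ) ≠ 0 := by
      simp [Real.pi_ne_zero, h]
    rw [integral_exp_mul_complex hm]
    have : cexp (2 * π * I * m * ((1 / 2 : ℝ) : ℂ)) =
        cexp (2 * π * I * m * ((-(1 / 2) : ℝ) : ℂ)) := by
      rw [Complex.exp_eq_exp_iff_exists_int]
      refine ⟨m, ?_⟩
      push_cast; ring
    rw [this, sub_self, zero_div]

/-- The character `e ^ (2 π i k x)`. -/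
noncomputable def character {d : ℕ} (k : Fin d → ℤ) (x : Space d) : ℂ :=
  cexp (2 * π * I * (⟪WithLp.toLp 2 (fun i ↦ (k i : ℝ)), x⟫_ℝ : ℝ))

theorem continuous_character {d : ℕ} (k : Fin d → ℤ) : Continuous (character k) := by
  unfold character; fun_prop

theorem norm_character {d : ℕ} (k : Fin d → ℤ) (x : Space d) : ‖character k x‖ = 1 := by
  rw [character, norm_exp]; simp

theorem memLp_character {d : ℕ} (k : Fin d → ℤ) :
    MemLp (character k) 2 (volume.restrict (unitCube d)) := by
  have : IsFiniteMeasure (volume.restrict (unitCube d)) :=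
    ⟨by simpa using volume_unitCube_lt_top d⟩
  exact MemLp.of_bound (continuous_character k).aestronglyMeasurable 1
    (Filter.Eventually.of_forall fun x ↦ (norm_character k x).le)

theorem conj_character_mul {d : ℕ} (k l : Fin d → ℤ) (x : Space d) :
    conj (character k x) * character l x = ∏ i, cexp (2 * π * I * ((l i - k i : ℤ) : ℂ) * (x i)) := by
  rw [character, character, ← Complex.exp_conj, ← Complex.exp_add, ← Complex.exp_sum]
  congr 1
  simp only [map_mul, conj_I, conj_ofReal, map_ofNat, PiLp.inner_apply]
  push_cast
  rw [Finset.mul_sum, Finset.mul_sum, ← Finset.sum_add_distrib]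
  refine Finset.sum_congr rfl fun i _ ↦ ?_
  simp
  ring

/-- The integral factors over the coordinates, and a coordinate where `k` and `l` differ gives zero.
Completeness is not needed: only Bessel's inequality is used. -/
theorem orthonormal_character (d : ℕ) :
    Orthonormal ℂ (fun k : Fin d → ℤ ↦ (memLp_character k).toLp (character k)) := by
  rw [orthonormal_iff_ite]
  intro k l
  rw [L2.inner_def]
  have h : ∫ x in unitCube d, inner ℂ ((memLp_character k).toLp (character k) x)
      ((memLp_character l).toLp (character l) x) =
      ∫ x in unitCube d, ∏ i, cexp (2 * π * I * ((l i - k i : ℤ) : ℂ) * (x i)) := by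
    refine integral_congr_ae ?_
    filter_upwards [(memLp_character k).coeFn_toLp, (memLp_character l).coeFn_toLp] with x h1 h2
    rw [h1, h2, ← conj_character_mul, RCLike.inner_apply, mul_comm]
  rw [h, integral_unitCube (fun i t ↦ cexp (2 * π * I * ((l i - k i : ℤ) : ℂ) * t))]
  simp_rw [integral_exp_Ico]
  by_cases hkl : k = l
  · simp [hkl]
  · obtain ⟨i, hi⟩ := Function.ne_iff.1 hkl
    rw [if_neg hkl]
    exact Finset.prod_eq_zero (Finset.mem_univ i) (if_neg (by omega))

/-- Bessel's inequality for the Fourier coefficients on the unit cube. -/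
theorem bessel_unitCube {d : ℕ} {G : Space d → ℂ} (hG : MemLp G 2) :
    Summable (fun k : Fin d → ℤ ↦ ‖∫ x in unitCube d, conj (character k x) * G x‖ ^ 2) ∧
      ∑' k : Fin d → ℤ, ‖∫ x in unitCube d, conj (character k x) * G x‖ ^ 2 ≤
        ∫ x in unitCube d, ‖G x‖ ^ 2 := by
  have hG' := hG.restrict (unitCube d)
  have hk : ∀ k, inner ℂ ((memLp_character k).toLp (character k)) (hG'.toLp G) =
      ∫ x in unitCube d, conj (character k x) * G x := by
    intro k
    rw [L2.inner_def]
    refine integral_congr_ae ?_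
    filter_upwards [(memLp_character k).coeFn_toLp, hG'.coeFn_toLp] with x h1 h2
    rw [h1, h2, RCLike.inner_apply, mul_comm]
  have hn : ‖hG'.toLp G‖ ^ 2 = ∫ x in unitCube d, ‖G x‖ ^ 2 := by
    have h := L2.inner_def (𝕜 := ℂ) (hG'.toLp G) (hG'.toLp G)
    rw [inner_self_eq_norm_sq_to_K] at h
    refine Complex.ofReal_injective ?_
    rw [Complex.ofReal_pow, ← integral_complex_ofReal]
    refine h.trans (integral_congr_ae ?_)
    filter_upwards [hG'.coeFn_toLp] with x h2
    rw [h2, inner_self_eq_norm_sq_to_K]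
    simp
  simp_rw [← hk, ← hn]
  exact ⟨(orthonormal_character d).inner_products_summable _,
    (orthonormal_character d).tsum_inner_products_le _⟩

/-- Bessel's inequality for a dilated system of exponentials. -/
theorem bessel_dilated {d : ℕ} (T : Space d ≃L[ℝ] Space d) {c : ℝ}
    (hc : c ^ 2 = |LinearMap.det (T : Space d →ₗ[ℝ] Space d)|) {F : Space d → ℂ} (hF : MemLp F 2) :
    Summable (fun k : Fin d → ℤ ↦
        ‖∫ x in T ⁻¹' unitCube d, conj ((c : ℂ) * character k (T x)) * F x‖ ^ 2) ∧
      ∑' k : Fin d → ℤ, ‖∫ x in T ⁻¹' unitCube d, conj ((c : ℂ) * character k (T x)) * F x‖ ^ 2 ≤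
        ∫ x in T ⁻¹' unitCube d, ‖F x‖ ^ 2 := by
  have hdet : c ^ 2 ≠ 0 := by
    rw [hc, abs_ne_zero]
    exact (LinearEquiv.isUnit_det' T.toLinearEquiv).ne_zero
  have hc0 : c ≠ 0 := fun h ↦ hdet (by simp [h])
  -- The factor `c⁻¹` makes `F ↦ G` preserve the `L²` norm, because `c ^ 2` is the Jacobian of `T`.
  have hG : MemLp (fun y ↦ ((c⁻¹ : ℝ) : ℂ) * F (T.symm y)) 2 :=
    (memLp_comp_continuousLinearEquiv T.symm hF).const_mul _
  have hE : MeasurableSet (T ⁻¹' unitCube d) :=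
    T.continuous.measurable (measurableSet_unitCube d)
  have hset : ∀ (V : Type) [NormedAddCommGroup V] [NormedSpace ℝ V] (H : Space d → V),
      ∫ x in T ⁻¹' unitCube d, H x = (c ^ 2)⁻¹ • ∫ y in unitCube d, H (T.symm y) := by
    intro V _ _ H
    rw [← integral_indicator hE, ← integral_indicator (measurableSet_unitCube d), hc,
      ← integral_comp_continuousLinearEquiv]
    congr 1 with x
    by_cases hx : T x ∈ unitCube d
    · rw [Set.indicator_of_mem (show x ∈ T ⁻¹' unitCube d from hx), Set.indicator_of_mem hx,
        T.symm_apply_apply]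
    · rw [Set.indicator_of_notMem (show x ∉ T ⁻¹' unitCube d from hx), Set.indicator_of_notMem hx]
  have h1 : ∀ k : Fin d → ℤ,
      ∫ x in T ⁻¹' unitCube d, conj ((c : ℂ) * character k (T x)) * F x =
      ∫ y in unitCube d, conj (character k y) * (((c⁻¹ : ℝ) : ℂ) * F (T.symm y)) := by
    intro k
    rw [hset, ← integral_smul]
    congr 1 with y
    rw [T.apply_symm_apply, Complex.real_smul]
    simp only [map_mul, conj_ofReal]
    push_cast
    field_simp
  have h2 : ∫ x in T ⁻¹' unitCube d, ‖F x‖ ^ 2 =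
      ∫ y in unitCube d, ‖((c⁻¹ : ℝ) : ℂ) * F (T.symm y)‖ ^ 2 := by
    rw [hset, ← integral_smul]
    congr 1 with y
    rw [norm_mul, norm_real, smul_eq_mul, mul_pow, Real.norm_eq_abs, sq_abs, inv_pow]
  simp_rw [h1, h2]
  exact bessel_unitCube hG
end WaveletFrame

/-! ### Frequency cut-off adapted to a dilation. -/

namespace WaveletFrame
open MeasureTheory Complex
open scoped FourierTransform Real InnerProductSpace ComplexConjugate

theorem det_adjoint {d : ℕ} (A : Space d →ₗ[ℝ] Space d) :
    LinearMap.det (LinearMap.adjoint A) = LinearMap.det A := by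
  obtain ⟨B, rfl⟩ := Matrix.toEuclideanLin.surjective A
  rw [← Matrix.toEuclideanLin_conjTranspose_eq_adjoint]
  erw [LinearMap.det_toLpLin, LinearMap.det_toLpLin]
  rw [Matrix.det_conjTranspose, star_trivial]

/-- The inverse of the adjoint. -/
noncomputable def contragredient {d : ℕ} (L : Space d ≃L[ℝ] Space d) : Space d ≃L[ℝ] Space d :=
  ContinuousLinearEquiv.equivOfInverse (L.symm : Space d →L[ℝ] Space d).adjoint
    (L : Space d →L[ℝ] Space d).adjoint
    (fun x ↦ ext_inner_left ℝ fun y ↦ by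
      rw [ContinuousLinearMap.adjoint_inner_right, ContinuousLinearMap.adjoint_inner_right]; simp)
    (fun x ↦ ext_inner_left ℝ fun y ↦ by
      rw [ContinuousLinearMap.adjoint_inner_right, ContinuousLinearMap.adjoint_inner_right]; simp)

theorem contragredient_apply {d : ℕ} (L : Space d ≃L[ℝ] Space d) (x : Space d) :
    contragredient L x = (L.symm : Space d →L[ℝ] Space d).adjoint x := rfl

theorem det_contragredient {d : ℕ} (L : Space d ≃L[ℝ] Space d) :
    LinearMap.det (contragredient L : Space d →ₗ[ℝ] Space d) =
      (LinearMap.det (L : Space d →ₗ[ℝ] Space d))⁻¹ := by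
  have h : (contragredient L : Space d →ₗ[ℝ] Space d) =
      LinearMap.adjoint (L.symm : Space d →ₗ[ℝ] Space d) := by
    ext1 x
    rfl
  rw [h, det_adjoint]
  refine eq_inv_of_mul_eq_one_left ?_
  rw [← LinearMap.det_comp]
  have : (L.symm : Space d →ₗ[ℝ] Space d) ∘ₗ (L : Space d →ₗ[ℝ] Space d) = LinearMap.id := by
    ext1 x; simp
  rw [this, LinearMap.det_id]

theorem norm_contragredient_le {d : ℕ} (L : Space d ≃L[ℝ] Space d) (x : Space d) :
    ‖contragredient L x‖ ≤ ‖(L.symm : Space d →L[ℝ] Space d)‖ * ‖x‖ := by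
  rw [contragredient_apply, ← ContinuousLinearMap.adjoint.norm_map (L.symm : Space d →L[ℝ] Space d)]
  exact ContinuousLinearMap.le_opNorm _ _

/-- Some coordinate has modulus at least `1 / 2`. The factor `2` becomes `4 ^ n` in the
high-frequency estimate. -/
theorem one_le_two_mul_norm_of_notMem_unitCube {d : ℕ} {x : Space d} (hx : x ∉ unitCube d) :
    1 ≤ 2 * ‖x‖ := by
  simp only [unitCube, Set.mem_ofPred_eq, not_forall] at hx
  obtain ⟨i, hi⟩ := hx
  have h := PiLp.norm_apply_le x i
  rw [Real.norm_eq_abs] at h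
  by_contra hlt
  rw [not_le] at hlt
  have := abs_lt.1 (show |x i| < 1 / 2 by linarith)
  exact hi ⟨by linarith [this.1], this.2⟩

/-- A function splits into a low-frequency part, on which a system of translates with
vanishing moments is small, and a small remainder. -/
theorem exists_lowFrequency_part {d n : ℕ} (L : Space d ≃L[ℝ] Space d) {f : L2 d}
    (hf : Integrable (fun ξ ↦ ‖ξ‖ ^ (2 * n) * ‖(𝓕 f : L2 d) ξ‖ ^ 2)) :
    ∃ fl : L2 d, ‖f - fl‖ ^ 2 ≤ 4 ^ n * ‖(L.symm : Space d →L[ℝ] Space d)‖ ^ (2 * n) *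
        ∫ ξ, ‖ξ‖ ^ (2 * n) * ‖(𝓕 f : L2 d) ξ‖ ^ 2 ∧
      ∀ (c C : ℝ) (g : Space d → ℂ), c ^ 2 = |LinearMap.det (L : Space d →ₗ[ℝ] Space d)| →
        Integrable g → (∀ η, ‖𝓕 g η‖ ≤ C * ‖η‖ ^ n) → ∀ w : (Fin d → ℤ) → L2 d,
        (∀ k, (fun x ↦ w k x) =ᵐ[volume]
          fun x ↦ (c : ℂ) * g (L x + WithLp.toLp 2 (fun i ↦ (k i : ℝ)))) →
        Summable (fun k ↦ ‖inner ℂ (w k) fl‖ ^ 2) ∧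
        ∑' k, ‖inner ℂ (w k) fl‖ ^ 2 ≤
          C ^ 2 * ‖(L.symm : Space d →L[ℝ] Space d)‖ ^ (2 * n) *
            ∫ ξ, ‖ξ‖ ^ (2 * n) * ‖(𝓕 f : L2 d) ξ‖ ^ 2 := by
  -- The cut-off depends on `L` alone, so one `fl` serves all generators.
  set T := contragredient L with hT
  set E : Set (Space d) := T ⁻¹' unitCube d with hEdef
  have hE : MeasurableSet E := T.continuous.measurable (measurableSet_unitCube d)
  have hmem := (Lp.memLp (𝓕 f : L2 d)).indicator hE
  set h : L2 d := hmem.toLp _ with hh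
  have hhae : (fun ξ ↦ h ξ) =ᵐ[volume] E.indicator (fun ξ ↦ (𝓕 f : L2 d) ξ) := hmem.coeFn_toLp
  set fl : L2 d := 𝓕⁻ h with hfl
  have hFfl : (𝓕 fl : L2 d) = h := FourierTransform.fourier_fourierInv_eq h
  set N := ‖(L.symm : Space d →L[ℝ] Space d)‖ with hN
  have hTn : ∀ ξ, ‖T ξ‖ ≤ N * ‖ξ‖ := norm_contragredient_le L
  refine ⟨fl, ?_, ?_⟩
  · have hsub : 𝓕 (f - fl) = 𝓕 f - (𝓕 fl : L2 d) :=
      (Lp.fourierTransformₗᵢ (Space d) ℂ).map_sub f fl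
    rw [← Lp.norm_fourier_eq, hsub, hFfl, norm_sq_eq_integral,
      ← integral_const_mul]
    refine integral_mono_ae (integrable_norm_sq _) (hf.const_mul _) ?_
    filter_upwards [hhae, Lp.coeFn_sub (𝓕 f : L2 d) h] with ξ h1 h2
    rw [h2, Pi.sub_apply, h1]
    by_cases hξ : ξ ∈ E
    · rw [Set.indicator_of_mem hξ, sub_self, norm_zero, zero_pow two_ne_zero]
      positivity
    · rw [Set.indicator_of_notMem hξ, sub_zero]
      have h3 : 1 ≤ 2 * (N * ‖ξ‖) := (one_le_two_mul_norm_of_notMem_unitCube hξ).trans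
        (by gcongr; exact hTn ξ)
      have h4 : 1 ≤ (2 * (N * ‖ξ‖)) ^ (2 * n) := one_le_pow₀ h3
      calc ‖(𝓕 f : L2 d) ξ‖ ^ 2 ≤ (2 * (N * ‖ξ‖)) ^ (2 * n) * ‖(𝓕 f : L2 d) ξ‖ ^ 2 :=
            le_mul_of_one_le_left (by positivity) h4
        _ = _ := by
            rw [mul_pow, mul_pow, pow_mul 2 2 n]
            norm_num
            ring
  · intro c C g hc hg hgC w hw
    have hdet : c ^ 2 ≠ 0 := by
      rw [hc, abs_ne_zero]
      exact (LinearEquiv.isUnit_det' L.toLinearEquiv).ne_zero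
    have hc0 : c ≠ 0 := fun h ↦ hdet (by simp [h])
    have hc' : (c⁻¹) ^ 2 = |LinearMap.det (T : Space d →ₗ[ℝ] Space d)| := by
      rw [hT, det_contragredient, abs_inv, ← hc, inv_pow]
    have hgc : Continuous (𝓕 g) := VectorFourier.fourierIntegral_continuous
      Real.continuous_fourierChar (L := innerₗ (Space d)) continuous_inner hg
    have hgb : ∀ η, ‖𝓕 g η‖ ≤ ∫ x, ‖g x‖ := fun η ↦
      VectorFourier.norm_fourierIntegral_le_integral_norm _ _ _ _ _
    set F : Space d → ℂ := fun ξ ↦ conj (𝓕 g (T ξ)) * (𝓕 f : L2 d) ξ with hFdef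
    have hFm : MemLp F 2 := by
      refine MemLp.of_le_mul (c := ∫ x, ‖g x‖) (Lp.memLp (𝓕 f : L2 d)) ?_
        (Filter.Eventually.of_forall fun ξ ↦ ?_)
      · refine AEStronglyMeasurable.mul (Continuous.aestronglyMeasurable ?_)
          (Lp.memLp (𝓕 f : L2 d)).aestronglyMeasurable
        exact Complex.continuous_conj.comp (hgc.comp T.continuous)
      · rw [hFdef, norm_mul, RCLike.norm_conj]
        gcongr
        exact hgb _
    -- The Fourier transform of `g (L x + k)` is `character k (T ξ) * 𝓕 g (T ξ)` divided by `|det L|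
    -- = c ^ 2`. Together with the factor `c` this leaves `c⁻¹`, the normalisation that makes the
    -- exponentials orthonormal on `E`.
    have hin : ∀ k, inner ℂ (w k) fl =
        ∫ ξ in E, conj (((c⁻¹ : ℝ) : ℂ) * character k (T ξ)) * F ξ := by
      intro k
      have hwint : Integrable (fun x ↦ (c : ℂ) * g (L x + WithLp.toLp 2 (fun i ↦ (k i : ℝ)))) := by
        refine Integrable.const_mul ?_ _
        have := memLp_comp_continuousLinearEquiv L
          (memLp_one_iff_integrable.2 (hg.comp_add_right (WithLp.toLp 2 (fun i ↦ (k i : ℝ)))))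
        exact memLp_one_iff_integrable.1 this
      have hwF := fourier_ae_eq_of_integrable (w k) (hw k) hwint
      rw [← Lp.inner_fourier_eq, hFfl, L2.inner_def, ← integral_indicator hE]
      refine integral_congr_ae ?_
      filter_upwards [hwF, hhae] with ξ h1 h2
      rw [h1, h2]
      by_cases hξ : ξ ∈ E
      · rw [Set.indicator_of_mem hξ, Set.indicator_of_mem hξ, RCLike.inner_apply, hFdef]
        have h3 : 𝓕 (fun x ↦ (c : ℂ) * g (L x + WithLp.toLp 2 (fun i ↦ (k i : ℝ)))) ξ =
            (c : ℂ) * 𝓕 (fun x ↦ g (L x + WithLp.toLp 2 (fun i ↦ (k i : ℝ)))) ξ := by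
          rw [Real.fourier_eq', Real.fourier_eq', ← integral_const_mul]
          congr 1 with x
          rw [smul_eq_mul, smul_eq_mul]
          ring
        rw [h3, fourier_comp_affine, ← contragredient_apply, ← hT, ← hc]
        change _ = _ * (_ * _)
        rw [character]
        simp only [map_mul, conj_ofReal]
        push_cast
        field_simp
      · rw [Set.indicator_of_notMem hξ, Set.indicator_of_notMem hξ, inner_zero_right]
    simp_rw [hin]
    obtain ⟨hs, hle⟩ := bessel_dilated T hc' hFm
    refine ⟨hs, hle.trans ?_⟩
    rw [← integral_const_mul]
    refine (setIntegral_le_integral (hFm.integrable_norm_pow two_ne_zero)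
      (Filter.Eventually.of_forall fun ξ ↦ by positivity)).trans ?_
    refine integral_mono (hFm.integrable_norm_pow two_ne_zero) (hf.const_mul _) fun ξ ↦ ?_
    simp only [hFdef]
    rw [norm_mul, RCLike.norm_conj, mul_pow]
    have hC : ‖𝓕 g (T ξ)‖ ≤ |C| * (N * ‖ξ‖) ^ n := by
      refine (hgC _).trans ?_
      gcongr
      · exact le_abs_self C
      · exact hTn ξ
    calc ‖𝓕 g (T ξ)‖ ^ 2 * ‖(𝓕 f : L2 d) ξ‖ ^ 2
        ≤ (|C| * (N * ‖ξ‖) ^ n) ^ 2 * ‖(𝓕 f : L2 d) ξ‖ ^ 2 := by gcongr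
      _ = _ := by
        rw [mul_pow, sq_abs]
        ring
end WaveletFrame

/-! ### Coefficients at a single scale and the tail of the expansion. -/

namespace WaveletFrame
open MeasureTheory Complex
open scoped FourierTransform Real InnerProductSpace ComplexConjugate

/-- Synthesis bound for a Bessel system. -/
theorem norm_sq_le_of_hasSum_smul {ι H : Type*} [NormedAddCommGroup H] [InnerProductSpace ℂ H]
    {w : ι → H} {c : ι → ℂ} {B : ℝ} (hB0 : 0 < B)
    (hB : ∀ v, Summable (fun p ↦ ‖inner ℂ (w p) v‖ ^ 2) ∧
      ∑' p, ‖inner ℂ (w p) v‖ ^ 2 ≤ B * ‖v‖ ^ 2)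
    (hc : Summable (fun p ↦ ‖c p‖ ^ 2)) {v : H} (hv : HasSum (fun p ↦ c p • w p) v) :
    ‖v‖ ^ 2 ≤ B * ∑' p, ‖c p‖ ^ 2 := by
  have h1 : HasSum (fun p ↦ inner ℂ v (c p • w p)) (inner ℂ v v) :=
    hv.mapL (innerSL ℂ v)
  have h2 := Complex.hasSum_re h1
  have h3 : (inner ℂ v v : ℂ).re = ‖v‖ ^ 2 := inner_self_eq_norm_sq (𝕜 := ℂ) v
  rw [h3] at h2
  obtain ⟨hs, hle⟩ := hB v
  -- Young's inequality with weight `B`, chosen so that the Bessel bound turns the second sum into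
  -- at most `‖v‖ ^ 2 / 2`, which is absorbed on the left.
  have h4 : HasSum (fun p ↦ (B / 2) * ‖c p‖ ^ 2 + (1 / (2 * B)) * ‖inner ℂ (w p) v‖ ^ 2)
      ((B / 2) * ∑' p, ‖c p‖ ^ 2 + (1 / (2 * B)) * ∑' p, ‖inner ℂ (w p) v‖ ^ 2) :=
    (hc.hasSum.mul_left _).add (hs.hasSum.mul_left _)
  have h5 := hasSum_le (fun p ↦ ?_) h2 h4
  · have h6 : (1 / (2 * B)) * ∑' p, ‖inner ℂ (w p) v‖ ^ 2 ≤ (1 / (2 * B)) * (B * ‖v‖ ^ 2) := by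
      gcongr
    have h7 : (1 / (2 * B)) * (B * ‖v‖ ^ 2) = ‖v‖ ^ 2 / 2 := by field_simp
    linarith
  · refine (Complex.re_le_norm _).trans ?_
    rw [inner_smul_right, norm_mul, norm_inner_symm]
    have h8 : 0 ≤ (B * ‖c p‖ - ‖inner ℂ (w p) v‖) ^ 2 / (2 * B) := by positivity
    have h9 : (B * ‖c p‖ - ‖inner ℂ (w p) v‖) ^ 2 / (2 * B) =
        (B / 2) * ‖c p‖ ^ 2 + (1 / (2 * B)) * ‖inner ℂ (w p) v‖ ^ 2 -
          ‖c p‖ * ‖inner ℂ (w p) v‖ := by field_simp; ring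
    linarith

theorem summable_section_and_tsum_le {α β : Type*} {a : α × β → ℝ} (ha : Summable a)
    (h0 : ∀ p, 0 ≤ a p) (i : α) :
    Summable (fun p ↦ a (i, p)) ∧ ∑' p, a (i, p) ≤ ∑' p, a p := by
  have hinj : Function.Injective (Prod.mk i : β → α × β) := Prod.mk_right_injective i
  exact ⟨ha.comp_injective hinj, tsum_comp_le_tsum_of_inj ha h0 hinj⟩

theorem summable_and_tsum_le_of_fiberwise {α : Type*} {r : ℕ} {a : α × Fin r → ℝ} {D : ℝ}
    (h0 : ∀ p, 0 ≤ a p) (h : ∀ ν, Summable (fun k ↦ a (k, ν)) ∧ ∑' k, a (k, ν) ≤ D) :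
    Summable a ∧ ∑' p, a p ≤ r * D := by
  have hs : Summable (a ∘ Prod.swap) :=
    (summable_prod_of_nonneg fun p ↦ h0 _).2 ⟨fun ν ↦ (h ν).1, Summable.of_finite⟩
  refine ⟨(Equiv.prodComm (Fin r) α).summable_iff.1 hs, ?_⟩
  rw [← (Equiv.prodComm (Fin r) α).tsum_eq a]
  have h1 := hs.tsum_prod' fun ν ↦ (h ν).1
  refine h1.trans_le ?_
  rw [tsum_fintype]
  refine (Finset.sum_le_sum fun ν _ ↦ (h ν).2).trans ?_
  simp

section Dilation
variable {d : ℕ} {M : Matrix (Fin d) (Fin d) ℤ}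

theorem IsDilationMatrix.det_map_ne_zero (hM : IsDilationMatrix M) :
    (M.map (Int.cast : ℤ → ℝ)).det ≠ 0 := by
  have h : (M.map (Int.cast : ℤ → ℝ)).det = (M.det : ℝ) :=
    (RingHom.map_det (Int.castRingHom ℝ) M).symm
  rw [h]
  exact_mod_cast hM.det_ne_zero

/-- The linear automorphism given by `M ^ j`. -/
noncomputable def IsDilationMatrix.dilation (hM : IsDilationMatrix M) (j : ℤ) :
    Space d ≃L[ℝ] Space d :=
  (LinearEquiv.ofLinearMap (Matrix.toEuclideanLin ((M.map (Int.cast : ℤ → ℝ)) ^ j))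
    (Matrix.toEuclideanLin ((M.map (Int.cast : ℤ → ℝ)) ^ (-j)))
    (by
      rw [← Matrix.toLpLin_mul_same, ← Matrix.zpow_add (isUnit_iff_ne_zero.2 hM.det_map_ne_zero)]
      simp)
    (by
      rw [← Matrix.toLpLin_mul_same, ← Matrix.zpow_add (isUnit_iff_ne_zero.2 hM.det_map_ne_zero)]
      simp)).toContinuousLinearEquiv

theorem IsDilationMatrix.dilation_apply (hM : IsDilationMatrix M) (j : ℤ) (x : Space d) :
    hM.dilation j x = Matrix.toEuclideanLin ((M.map (Int.cast : ℤ → ℝ)) ^ j) x := rfl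

theorem IsDilationMatrix.dilation_symm_apply (hM : IsDilationMatrix M) (j : ℤ) (x : Space d) :
    (hM.dilation j).symm x = Matrix.toEuclideanLin ((M.map (Int.cast : ℤ → ℝ)) ^ (-j)) x := rfl

/-- Identifies the wavelet normalisation with the constant `c` required by
`exists_lowFrequency_part`. -/
theorem IsDilationMatrix.sq_rpow_eq_abs_det (hM : IsDilationMatrix M) (j : ℤ) :
    (|(M.det : ℝ)| ^ ((j : ℝ) / 2)) ^ 2 =
      |LinearMap.det (hM.dilation j : Space d →ₗ[ℝ] Space d)| := by
  have h1 : (hM.dilation j : Space d →ₗ[ℝ] Space d) =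
      Matrix.toEuclideanLin ((M.map (Int.cast : ℤ → ℝ)) ^ j) := rfl
  have h : (M.map (Int.cast : ℤ → ℝ)).det = (M.det : ℝ) :=
    (RingHom.map_det (Int.castRingHom ℝ) M).symm
  have h2 : ((M.map (Int.cast : ℤ → ℝ)) ^ j).det = (M.map (Int.cast : ℤ → ℝ)).det ^ j := by
    obtain ⟨k, rfl | rfl⟩ := j.eq_nat_or_neg
    · rw [zpow_natCast, zpow_natCast, Matrix.det_pow]
    · rw [Matrix.zpow_neg_natCast, Matrix.det_nonsing_inv, Ring.inverse_eq_inv', Matrix.det_pow,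
        zpow_neg, zpow_natCast]
  rw [h1, LinearMap.det_toLpLin, h2, h, abs_zpow, ← Real.rpow_natCast, ← Real.rpow_mul (abs_nonneg _)]
  norm_num

theorem wavelet_ae_eq (hM : IsDilationMatrix M) (ψ : L2 d) (j : ℤ) (k : Fin d → ℤ) :
    (fun x ↦ wavelet hM ψ j k x) =ᵐ[volume] fun x ↦ ((|(M.det : ℝ)| ^ ((j : ℝ) / 2) : ℝ) : ℂ) *
      ψ (hM.dilation j x + WithLp.toLp 2 (fun i ↦ (k i : ℝ))) :=
  MemLp.coeFn_toLp _

/-- The frame coefficients of a Sobolev function at a single scale. -/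
theorem tsum_inner_wavelet_le (hM : IsDilationMatrix M) {r n : ℕ} {ψ : Fin r → L2 d} {B C : ℝ}
    (hB : ∀ (i : ℤ) (f : L2 d),
      Summable (fun p : (Fin d → ℤ) × Fin r ↦ ‖inner ℂ (wavelet hM (ψ p.2) i p.1) f‖ ^ 2) ∧
      ∑' p : (Fin d → ℤ) × Fin r, ‖inner ℂ (wavelet hM (ψ p.2) i p.1) f‖ ^ 2 ≤ B * ‖f‖ ^ 2)
    (hB0 : 0 ≤ B) (hint : ∀ ν, Integrable (fun x ↦ ψ ν x))
    (hC : ∀ ν η, ‖𝓕 (fun x ↦ ψ ν x) η‖ ≤ C * ‖η‖ ^ n) {f : L2 d} (hf : MemW n f) (i : ℤ) :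
    ∑' p : (Fin d → ℤ) × Fin r, ‖inner ℂ (wavelet hM (ψ p.2) i p.1) f‖ ^ 2 ≤
      (2 * (r * C ^ 2 + B * 4 ^ n) * n.factorial) *
        ‖((hM.dilation i).symm : Space d →L[ℝ] Space d)‖ ^ (2 * n) * sobolevNorm n f ^ 2 := by
  obtain ⟨hfI, hfle⟩ := hf.integral_fourier_le
  obtain ⟨fl, hhigh, hlow⟩ := exists_lowFrequency_part (hM.dilation i) hfI
  set N := ‖((hM.dilation i).symm : Space d →L[ℝ] Space d)‖ with hN
  set I := ∫ ξ, ‖ξ‖ ^ (2 * n) * ‖(𝓕 f : L2 d) ξ‖ ^ 2 with hI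
  have hlow' : ∀ ν, Summable (fun k ↦ ‖inner ℂ (wavelet hM (ψ ν) i k) fl‖ ^ 2) ∧
      ∑' k, ‖inner ℂ (wavelet hM (ψ ν) i k) fl‖ ^ 2 ≤ C ^ 2 * N ^ (2 * n) * I := fun ν ↦
    hlow _ C _ (hM.sq_rpow_eq_abs_det i) (hint ν) (hC ν)
      (fun k ↦ wavelet hM (ψ ν) i k) (fun k ↦ wavelet_ae_eq hM (ψ ν) i k)
  obtain ⟨hsum', hlowle⟩ := summable_and_tsum_le_of_fiberwise
    (a := fun p : (Fin d → ℤ) × Fin r ↦ ‖inner ℂ (wavelet hM (ψ p.2) i p.1) fl‖ ^ 2)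
    (fun p ↦ by positivity) hlow'
  obtain ⟨hhs, hhle⟩ := hB i (f - fl)
  have hterm : ∀ p : (Fin d → ℤ) × Fin r, ‖inner ℂ (wavelet hM (ψ p.2) i p.1) f‖ ^ 2 ≤
      2 * ‖inner ℂ (wavelet hM (ψ p.2) i p.1) fl‖ ^ 2 +
        2 * ‖inner ℂ (wavelet hM (ψ p.2) i p.1) (f - fl)‖ ^ 2 := by
    intro p
    rw [inner_sub_right]
    set a := inner ℂ (wavelet hM (ψ p.2) i p.1) f
    set b := inner ℂ (wavelet hM (ψ p.2) i p.1) fl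
    have h : ‖a‖ ≤ ‖b‖ + ‖a - b‖ := norm_le_norm_add_norm_sub' a b
    nlinarith [norm_nonneg a, norm_nonneg b, norm_nonneg (a - b), sq_nonneg (‖b‖ - ‖a - b‖)]
  have h1 := (hB i f).1.tsum_le_tsum hterm ((hsum'.mul_left 2).add (hhs.mul_left 2))
  rw [((hsum'.mul_left 2).tsum_add (hhs.mul_left 2)), tsum_mul_left, tsum_mul_left] at h1
  refine h1.trans ?_
  calc _ ≤ 2 * (r * (C ^ 2 * N ^ (2 * n) * I)) + 2 * (B * (4 ^ n * N ^ (2 * n) * I)) := by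
        refine add_le_add (mul_le_mul_of_nonneg_left hlowle zero_le_two)
          (mul_le_mul_of_nonneg_left (hhle.trans ?_) zero_le_two)
        gcongr
    _ = (2 * (r * C ^ 2 + B * 4 ^ n)) * N ^ (2 * n) * I := by ring
    _ ≤ (2 * (r * C ^ 2 + B * 4 ^ n)) * N ^ (2 * n) * (n.factorial * sobolevNorm n f ^ 2) := by
        gcongr
    _ = _ := by ring

theorem IsFrame.exists_bessel {r : ℕ} {hM : IsDilationMatrix M} {ψ : Fin r → L2 d}
    (h : IsFrame hM ψ) : ∃ B : ℝ, 0 < B ∧ ∀ f : L2 d,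
      Summable (fun p : ℤ × (Fin d → ℤ) × Fin r ↦
        ‖inner ℂ (wavelet hM (ψ p.2.2) p.1 p.2.1) f‖ ^ 2) ∧
      ∑' p : ℤ × (Fin d → ℤ) × Fin r,
        ‖inner ℂ (wavelet hM (ψ p.2.2) p.1 p.2.1) f‖ ^ 2 ≤ B * ‖f‖ ^ 2 := by
  obtain ⟨A, B, -, hB, hf⟩ := h
  refine ⟨B, hB, fun f ↦ ?_⟩
  obtain ⟨s, hs, -, hle⟩ := hf f
  exact ⟨hs.summable, hs.tsum_eq.trans_le hle⟩

/-- The tail of the frame expansion of a Sobolev function is controlled by the decay of the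
inverse dilations. -/
theorem approximatesAtRate_of_norm_le {hM : IsDilationMatrix M} {r n : ℕ} (hn : 1 ≤ n)
    {ψ ψ' : Fin r → L2 d} (hdual : AreDualFrames hM ψ ψ')
    (hint : ∀ ν, Integrable (fun x ↦ ψ' ν x)) {C : ℝ}
    (hC : ∀ ν η, ‖𝓕 (fun x ↦ ψ' ν x) η‖ ≤ C * ‖η‖ ^ n) {lam K : ℝ} (hlam : 1 < lam)
    (hK : ∀ i : ℕ, ‖((hM.dilation i).symm : Space d →L[ℝ] Space d)‖ ≤ K / lam ^ i) :
    ApproximatesAtRate hM ψ ψ' n lam := by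
  obtain ⟨B, hB0, hB⟩ := hdual.frame.exists_bessel
  obtain ⟨B', hB'0, hB'⟩ := hdual.dual_frame.exists_bessel
  have hlam0 : 0 < lam := by linarith
  have hscale : ∀ (i : ℤ) (f : L2 d),
      Summable (fun p : (Fin d → ℤ) × Fin r ↦ ‖inner ℂ (wavelet hM (ψ' p.2) i p.1) f‖ ^ 2) ∧
      ∑' p : (Fin d → ℤ) × Fin r, ‖inner ℂ (wavelet hM (ψ' p.2) i p.1) f‖ ^ 2 ≤ B' * ‖f‖ ^ 2 := by
    intro i f
    obtain ⟨hs, hle⟩ := hB' f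
    have h := summable_section_and_tsum_le hs (fun _ ↦ by positivity) i
    exact ⟨h.1, h.2.trans hle⟩
  set A₀ : ℝ := (2 * (r * C ^ 2 + B' * 4 ^ n) * n.factorial) * K ^ (2 * n) with hA₀
  have hA₀0 : 0 ≤ A₀ := by
    have : 0 ≤ K ^ (2 * n) := by rw [pow_mul]; positivity
    positivity
  -- The ratio of the geometric series over scales; `n ≥ 1` makes it less than `1`.
  set q : ℝ := (lam ^ (2 * n))⁻¹ with hq
  have hq0 : 0 < q := by positivity
  have hq1 : q < 1 := inv_lt_one_of_one_lt₀ (one_lt_pow₀ hlam (by omega))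
  -- The term `B'` serves `j < 0`, and the geometric sum `A₀ / (1 - q)` serves `j ≥ 0`.
  set G : ℝ := B' + A₀ / (1 - q) with hG
  have hq1' : 0 < 1 - q := by linarith
  have hG0 : 0 ≤ G := by positivity
  -- The `+ 1` only makes positivity immediate.
  refine ⟨√(B * G) + 1, by positivity, fun f hf j ↦ ?_⟩
  set F : ℤ × (Fin d → ℤ) × Fin r → L2 d := fun p ↦
    expansionTerm hM (ψ p.2.2) (ψ' p.2.2) f p.1 p.2.1 with hF
  have hFs : HasSum F f := hdual.expansion f
  set ι : Set.Iio j × (Fin d → ℤ) × Fin r → ℤ × (Fin d → ℤ) × Fin r :=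
    fun p ↦ (p.1, p.2) with hι
  have hιinj : Function.Injective ι := by
    rintro ⟨a, b⟩ ⟨a', b'⟩ h
    simp only [hι, Prod.mk.injEq] at h
    exact Prod.ext (Subtype.ext h.1) h.2
  have hS : HasSum (F ∘ ι) (∑' p, F (ι p)) := (hFs.summable.comp_injective hιinj).hasSum
  refine ⟨∑' p, F (ι p), hS, ?_⟩
  set S := ∑' p, F (ι p)
  have hS2 : HasSum (fun p ↦ if p.1 < j then F p else 0) S := by
    rw [← hιinj.hasSum_iff]
    · convert hS using 1
      ext1 p
      have : (p.1 : ℤ) < j := p.1.2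
      simp [hι, this]
    · intro p hp
      refine if_neg fun h ↦ hp ⟨(⟨p.1, h⟩, p.2), rfl⟩
  set c : ℤ × (Fin d → ℤ) × Fin r → ℂ := fun p ↦
    if p.1 < j then 0 else inner ℂ (wavelet hM (ψ' p.2.2) p.1 p.2.1) f with hc
  -- The error is itself a synthesis in the system `ψ`, with the coefficients of scale below `j`
  -- replaced by zero.
  have hD : HasSum (fun p ↦ c p • wavelet hM (ψ p.2.2) p.1 p.2.1) (f - S) := by
    convert hFs.sub hS2 using 1
    ext1 p
    simp only [hc, hF, expansionTerm]
    split_ifs <;> simp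
  obtain ⟨hfs, hfle⟩ := hB' f
  have hcle : ∀ p, ‖c p‖ ^ 2 ≤ ‖inner ℂ (wavelet hM (ψ' p.2.2) p.1 p.2.1) f‖ ^ 2 := by
    intro p
    simp only [hc]
    split_ifs
    · rw [norm_zero, zero_pow two_ne_zero]; positivity
    · rfl
  have hcs : Summable (fun p ↦ ‖c p‖ ^ 2) := hfs.of_nonneg_of_le (fun _ ↦ by positivity) hcle
  have hmain := norm_sq_le_of_hasSum_smul hB0 hB hcs hD
  have hsob : 0 ≤ sobolevNorm n f := Real.sqrt_nonneg _
  have hcoef : ∑' p, ‖c p‖ ^ 2 ≤ G * (sobolevNorm n f / lam ^ (j * (n : ℤ))) ^ 2 := by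
    -- The bound `hK` covers nonnegative scales only. For `j < 0` the factor `lam ^ (j * n)` is at
    -- most `1`, and the Bessel bound suffices.
    rcases lt_or_ge j 0 with hj | hj
    · have h1 : sobolevNorm n f ≤ sobolevNorm n f / lam ^ (j * (n : ℤ)) := by
        refine le_div_self hsob (by positivity) (zpow_le_one_of_nonpos₀ hlam.le ?_)
        exact mul_nonpos_of_nonpos_of_nonneg hj.le (by positivity)
      calc _ ≤ _ := hcs.tsum_le_tsum hcle hfs
        _ ≤ B' * ‖f‖ ^ 2 := hfle
        _ ≤ G * (sobolevNorm n f / lam ^ (j * (n : ℤ))) ^ 2 := by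
          gcongr
          · exact le_add_of_nonneg_right (by positivity)
          · exact hf.norm_le_sobolevNorm.trans h1
    · obtain ⟨J, rfl⟩ := Int.eq_ofNat_of_zero_le hj
      set t : ℤ → ℝ := fun i ↦ ∑' p : (Fin d → ℤ) × Fin r, ‖c (i, p)‖ ^ 2 with ht
      have htot : ∑' p, ‖c p‖ ^ 2 = ∑' i, t i := hcs.tsum_prod
      have hts : Summable t := hcs.prod
      have hinj : Function.Injective (fun m : ℕ ↦ (J : ℤ) + m) := fun a b h ↦ by simpa using h
      -- Scales below `J` carry no coefficients, so the sum over `ℤ` becomes one over `J + ℕ`.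
      have htsupp : Function.support t ⊆ Set.range (fun m : ℕ ↦ (J : ℤ) + m) := by
        intro i hi
        by_contra hcon
        apply hi
        have hlt : i < J := by
          by_contra hge
          exact hcon ⟨(i - J).toNat, by simp only; omega⟩
        simp [ht, hc, hlt]
      rw [htot, ← hinj.tsum_eq htsupp]
      have hterm : ∀ m : ℕ, t ((J : ℤ) + m) ≤ A₀ * sobolevNorm n f ^ 2 * q ^ J * q ^ m := by
        intro m
        have hge : ¬ ((J : ℤ) + m < J) := by omega
        simp only [ht, hc, hge, if_false]
        refine (tsum_inner_wavelet_le hM hscale hB'0.le hint hC hf _).trans ?_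
        have hKm := hK (J + m)
        push_cast at hKm
        calc _ ≤ (2 * (r * C ^ 2 + B' * 4 ^ n) * n.factorial) *
              (K / lam ^ (J + m)) ^ (2 * n) * sobolevNorm n f ^ 2 := by gcongr
          _ = _ := by
              rw [hA₀, div_pow, ← pow_mul, hq, inv_pow, inv_pow, ← pow_mul, ← pow_mul]
              field_simp
              ring
      have hgeo : HasSum (fun m : ℕ ↦ A₀ * sobolevNorm n f ^ 2 * q ^ J * q ^ m)
          (A₀ * sobolevNorm n f ^ 2 * q ^ J * (1 - q)⁻¹) :=
        (hasSum_geometric_of_lt_one hq0.le hq1).mul_left _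
      refine ((hts.comp_injective hinj).tsum_le_tsum hterm hgeo.summable).trans ?_
      rw [hgeo.tsum_eq]
      have hqJ : (sobolevNorm n f / lam ^ ((J : ℤ) * (n : ℤ))) ^ 2 =
          sobolevNorm n f ^ 2 * q ^ J := by
        rw [div_pow, hq, inv_pow, ← pow_mul, div_eq_mul_inv, ← Nat.cast_mul, zpow_natCast,
          ← pow_mul]
        congr 3
        ring
      rw [hqJ]
      calc _ = (A₀ / (1 - q)) * (sobolevNorm n f ^ 2 * q ^ J) := by ring
        _ ≤ G * (sobolevNorm n f ^ 2 * q ^ J) := by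
          gcongr
          exact le_add_of_nonneg_left hB'0.le
  have hX0 : 0 ≤ sobolevNorm n f / lam ^ (j * (n : ℤ)) := by positivity
  have h2 : ‖f - S‖ ^ 2 ≤ (√(B * G) * (sobolevNorm n f / lam ^ (j * (n : ℤ)))) ^ 2 := by
    rw [mul_pow, Real.sq_sqrt (by positivity), mul_assoc]
    exact hmain.trans (by gcongr)
  have h3 := (pow_le_pow_iff_left₀ (norm_nonneg _) (by positivity) two_ne_zero).1 h2
  rw [mul_div_assoc]
  refine h3.trans ?_
  gcongr
  linarith
end Dilation
end WaveletFrame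

/-! ### Decay of the inverse dilations, and exclusion of dimension zero. -/

namespace WaveletFrame
open MeasureTheory Complex
open scoped FourierTransform Real InnerProductSpace ComplexConjugate

/-- Powers of an element of a Banach algebra grow no faster than any rate above the spectral
radius. -/
theorem exists_norm_pow_le_of_spectrum_lt {A : Type*} [NormedRing A] [NormedAlgebra ℂ A]
    [CompleteSpace A] [Nontrivial A] (a : A) {ρ : ℝ} (hρ : 0 < ρ)
    (h : ∀ z ∈ spectrum ℂ a, ‖z‖ < ρ) : ∃ K : ℝ, ∀ k : ℕ, ‖a ^ k‖ ≤ K * ρ ^ k := by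
  lift ρ to NNReal using hρ.le
  have h1 : spectralRadius ℂ a < (ρ : ENNReal) :=
    spectrum.spectralRadius_lt_of_forall_lt a fun z hz ↦ NNReal.coe_lt_coe.1 (h z hz)
  -- Gelfand's formula gives the bound for large `k`; the finitely many other powers are absorbed
  -- into `K`.
  have h2 := (spectrum.pow_nnnorm_pow_one_div_tendsto_nhds_spectralRadius a).eventually_lt_const h1
  have h3 : ∀ᶠ k : ℕ in Filter.atTop, ‖a ^ k‖ / ρ ^ k ≤ 1 := by
    filter_upwards [h2, Filter.eventually_gt_atTop 0] with k hk hk0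
    have hk0' : (0 : ℝ) < k := by exact_mod_cast hk0
    rw [← ENNReal.coe_rpow_of_nonneg _ (by positivity), ENNReal.coe_lt_coe, ← NNReal.coe_lt_coe,
      NNReal.coe_rpow, coe_nnnorm] at hk
    rw [div_le_one (by positivity)]
    have := Real.rpow_le_rpow (by positivity) hk.le hk0'.le
    rwa [← Real.rpow_mul (norm_nonneg _), one_div_mul_cancel hk0'.ne', Real.rpow_one,
      Real.rpow_natCast] at this
  obtain ⟨K, hK⟩ := (Filter.isBoundedUnder_of_eventually_le h3).bddAbove_range
  refine ⟨K, fun k ↦ ?_⟩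
  have := hK ⟨k, rfl⟩
  rwa [div_le_iff₀ (by positivity)] at this

/-- The complexification of a real vector. -/
noncomputable def complexify {d : ℕ} (x : Space d) : EuclideanSpace ℂ (Fin d) :=
  WithLp.toLp 2 fun i ↦ (x i : ℂ)

theorem norm_complexify {d : ℕ} (x : Space d) : ‖complexify x‖ = ‖x‖ := by
  rw [EuclideanSpace.norm_eq, EuclideanSpace.norm_eq]
  simp [complexify]

-- Gelfand's formula lives over `ℂ`. Complexification is isometric on real vectors, so complex
-- operator norms bound the real dilations.
open scoped Matrix.Norms.L2Operator in
theorem norm_toEuclideanLin_le_norm_map {d : ℕ} (B : Matrix (Fin d) (Fin d) ℝ) (x : Space d) :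
    ‖Matrix.toEuclideanLin B x‖ ≤ ‖B.map (fun t ↦ (t : ℂ))‖ * ‖x‖ := by
  rw [← norm_complexify x, ← norm_complexify (Matrix.toEuclideanLin B x)]
  have h := (B.map (fun t ↦ (t : ℂ))).l2_opNorm_mulVec (complexify x)
  convert h using 2
  ext i
  simp [complexify, Matrix.mulVec, dotProduct]

section Dilation
variable {d : ℕ} {M : Matrix (Fin d) (Fin d) ℤ}

-- The inverse of the complexified matrix has the reciprocal spectrum, which lies in the open disc
-- of radius `lam⁻¹`. Nonzero dimension makes the matrix algebra nontrivial.
open scoped Matrix.Norms.L2Operator in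
theorem IsDilationMatrix.exists_norm_dilation_symm_le [NeZero d] (hM : IsDilationMatrix M) {lam : ℝ}
    (hlam : 0 < lam) (h : ∀ z ∈ spectrum ℂ (M.map (Int.cast : ℤ → ℂ)), lam < ‖z‖) :
    ∃ K : ℝ, ∀ i : ℕ, ‖((hM.dilation i).symm : Space d →L[ℝ] Space d)‖ ≤ K / lam ^ i := by
  set Mr := M.map (Int.cast : ℤ → ℝ) with hMr
  set Mc := M.map (Int.cast : ℤ → ℂ) with hMc
  have hMc' : Mc = Mr.map (fun t ↦ (t : ℂ)) := by
    ext i j; simp [hMc, hMr]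
  have hdetr : IsUnit Mr.det := isUnit_iff_ne_zero.2 hM.det_map_ne_zero
  have hinv : ∀ k : ℕ, (Mr ^ (-(k : ℤ))).map (fun t ↦ (t : ℂ)) * Mc ^ k = 1 := by
    intro k
    have h1 : Mc ^ k = (Mr ^ k).map (fun t ↦ (t : ℂ)) := by
      rw [hMc']
      exact (map_pow (Complex.ofRealHom.mapMatrix : Matrix (Fin d) (Fin d) ℝ →+* _) Mr k).symm
    rw [h1]
    have h2 := map_mul (Complex.ofRealHom.mapMatrix : Matrix (Fin d) (Fin d) ℝ →+* _)
      (Mr ^ (-(k : ℤ))) (Mr ^ k)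
    refine h2.symm.trans ?_
    rw [← zpow_natCast Mr k, Matrix.zpow_neg_mul_zpow_self _ hdetr, map_one]
  have hdetc : IsUnit Mc := by
    have := hinv 1
    rw [pow_one] at this
    exact IsUnit.of_mul_eq_one_right _ this
  obtain ⟨u, hu⟩ := hdetc
  obtain ⟨K, hK⟩ := exists_norm_pow_le_of_spectrum_lt (↑u⁻¹ : Matrix (Fin d) (Fin d) ℂ)
    (inv_pos.2 hlam) (fun z hz ↦ by
      rw [← spectrum.map_inv, Set.mem_inv, hu] at hz
      have h1 := h _ hz
      rw [norm_inv] at h1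
      exact (lt_inv_comm₀ hlam (inv_pos.1 (hlam.trans h1))).1 h1)
  have hpow : ∀ k : ℕ, (Mr ^ (-(k : ℤ))).map (fun t ↦ (t : ℂ)) =
      (↑u⁻¹ : Matrix (Fin d) (Fin d) ℂ) ^ k := by
    intro k
    have h1 := hinv k
    rw [← hu, ← Units.val_pow_eq_pow_val] at h1
    rw [← Units.val_pow_eq_pow_val, inv_pow]
    exact Units.eq_inv_of_mul_eq_one_right h1
  refine ⟨K, fun i ↦ ?_⟩
  have hK0 : 0 ≤ K * lam⁻¹ ^ i := (norm_nonneg _).trans (hK i)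
  rw [div_eq_mul_inv, ← inv_pow]
  refine ContinuousLinearMap.opNorm_le_bound _ hK0 fun x ↦ ?_
  change ‖(hM.dilation i).symm x‖ ≤ _
  rw [hM.dilation_symm_apply]
  refine (norm_toEuclideanLin_le_norm_map _ x).trans ?_
  rw [hpow i]
  gcongr
  exact hK i

theorem IsDilationMatrix.norm_dilation_symm_le_of_eq_smul_one (hM : IsDilationMatrix M) {c : ℤ}
    (hc : c ≠ 0) (h : M = c • (1 : Matrix (Fin d) (Fin d) ℤ)) (i : ℕ) :
    ‖((hM.dilation i).symm : Space d →L[ℝ] Space d)‖ ≤ 1 / |(c : ℝ)| ^ i := by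
  have hc0 : (c : ℝ) ≠ 0 := by exact_mod_cast hc
  have hMr : M.map (Int.cast : ℤ → ℝ) = (c : ℝ) • (1 : Matrix (Fin d) (Fin d) ℝ) := by
    ext a b
    simp only [h, Matrix.map_apply, Matrix.smul_apply, Matrix.one_apply]
    split_ifs <;> simp
  refine ContinuousLinearMap.opNorm_le_bound _ (by positivity) fun x ↦ ?_
  obtain ⟨y, rfl⟩ := (hM.dilation i).surjective x
  change ‖(hM.dilation i).symm (hM.dilation i y)‖ ≤ _
  rw [ContinuousLinearEquiv.symm_apply_apply]
  have : hM.dilation i y = (c : ℝ) ^ i • y := by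
    rw [hM.dilation_apply, hMr, zpow_natCast, smul_pow, one_pow, map_smul, Matrix.toLpLin_one]
    rfl
  rw [this, norm_smul, norm_pow, Real.norm_eq_abs]
  have hne : |(c : ℝ)| ^ i ≠ 0 := by positivity
  field_simp
  exact le_rfl

theorem IsDilationMatrix.one_lt_abs_of_eq_smul_one [NeZero d] (hM : IsDilationMatrix M) {c : ℤ}
    (h : M = c • (1 : Matrix (Fin d) (Fin d) ℤ)) : 1 < |(c : ℝ)| := by
  have hMc : M.map (Int.cast : ℤ → ℂ) = algebraMap ℂ (Matrix (Fin d) (Fin d) ℂ) c := by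
    rw [Algebra.algebraMap_eq_smul_one]
    ext a b
    simp only [h, Matrix.map_apply, Matrix.smul_apply, Matrix.one_apply]
    split_ifs <;> simp
  have h1 := hM.one_lt_norm c (by rw [hMc, spectrum.scalar_eq]; rfl)
  simpa using h1

-- The spectrum is compact and nonempty, so the minimal modulus is attained and exceeds `1`; the
-- witness is the midpoint between the two.
open scoped Matrix.Norms.L2Operator in
theorem IsDilationMatrix.exists_lt_norm [NeZero d] (hM : IsDilationMatrix M) :
    ∃ lam : ℝ, 1 < lam ∧ ∀ z ∈ spectrum ℂ (M.map (Int.cast : ℤ → ℂ)), lam < ‖z‖ := by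
  obtain ⟨z₀, hz₀, hmin⟩ := (spectrum.isCompact (𝕜 := ℂ) (M.map (Int.cast : ℤ → ℂ))).exists_isMinOn
    (spectrum.nonempty _) continuous_norm.continuousOn
  have h1 := hM.one_lt_norm z₀ hz₀
  refine ⟨(1 + ‖z₀‖) / 2, by linarith, fun z hz ↦ ?_⟩
  have : ‖z₀‖ ≤ ‖z‖ := hmin hz
  linarith

/-- There are no wavelet frames in dimension zero. -/
theorem IsFrame.dim_ne_zero {r : ℕ} {hM : IsDilationMatrix M} {ψ : Fin r → L2 d}
    (h : IsFrame hM ψ) : d ≠ 0 := by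
  rintro rfl
  obtain ⟨A, B, hA, -, hf⟩ := h
  -- In dimension zero all scales give the same element, so summability over `ℤ` forces every
  -- coefficient to vanish. The lower frame bound then gives `f = 0` for all `f`, contradicting the
  -- nonzero constant function.
  have hw : ∀ ν (j : ℤ) (k : Fin 0 → ℤ), wavelet hM (ψ ν) j k = wavelet hM (ψ ν) 0 k := by
    intro ν j k
    unfold wavelet
    congr 1
    ext1 x
    simp only [dilateTranslate, Matrix.det_isEmpty, Int.cast_one, abs_one, Real.one_rpow]
    congr 2
  have hzero : ∀ f : L2 0, f = 0 := by
    intro f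
    obtain ⟨s, hs, hle, -⟩ := hf f
    have hs0 : s = 0 := by
      refine hs.unique ?_
      convert hasSum_zero with p
      obtain ⟨j, x⟩ := p
      have h1 : Summable (fun _ : ℤ ↦ ‖inner ℂ (wavelet hM (ψ x.2) 0 x.1) f‖ ^ 2) := by
        have := hs.summable.comp_injective (Prod.mk_left_injective x)
        refine this.congr fun j ↦ ?_
        simp only [Function.comp_apply]
        rw [hw]
      simp only
      rw [hw]
      exact (summable_const_iff _).1 h1
    rw [hs0] at hle
    have : ‖f‖ ^ 2 ≤ 0 := by
      by_contra hcon
      rw [not_le] at hcon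
      nlinarith [mul_pos hA hcon]
    simpa using this
  have hfin : (volume : Measure (Space 0)) Set.univ ≠ ⊤ := by
    have := volume_unitCube_lt_top 0
    rwa [show unitCube 0 = Set.univ by ext x; simp [unitCube], lt_top_iff_ne_top] at this
  have h1 := norm_indicatorConstLp (p := 2) (hs := MeasurableSet.univ) (hμs := hfin) (c := (1 : ℂ))
    two_ne_zero ENNReal.ofNat_ne_top
  rw [hzero (indicatorConstLp 2 MeasurableSet.univ hfin (1 : ℂ)), norm_zero, norm_one, one_mul] at h1
  have h2 : 0 < (volume : Measure (Space 0)).real Set.univ :=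
    ENNReal.toReal_pos (IsOpen.measure_ne_zero _ isOpen_univ Set.univ_nonempty) hfin
  exact (Real.rpow_pos_of_pos h2 _).ne h1
end Dilation
end WaveletFrame

/-! ### The main theorem. -/

theorem theorem4 {d r n : ℕ} (hn : 1 ≤ n) {M : Matrix (Fin d) (Fin d) ℤ}
    (hM : WaveletFrame.IsDilationMatrix M) (ψ ψ' : Fin r → WaveletFrame.L2 d)
    (hdual : WaveletFrame.AreDualFrames hM ψ ψ')
    (C₁ γ : ℝ) (hγ : (n : ℝ) + (d : ℝ) < γ)
    (hψ : ∀ ν, ∀ᵐ x : WaveletFrame.Space d, ‖ψ ν x‖ ≤ C₁ / (1 + ‖x‖) ^ γ)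
    (hψ' : ∀ ν, ∀ᵐ x : WaveletFrame.Space d, ‖ψ' ν x‖ ≤ C₁ / (1 + ‖x‖) ^ γ)
    (hVM : WaveletFrame.HasVanishingMoments (n - 1) ψ') :
    WaveletFrame.HasApproximationOrder hM ψ ψ' n ∧
      (∀ lam : ℝ, 1 < lam → (∀ z ∈ spectrum ℂ (M.map (Int.cast : ℤ → ℂ)), lam < ‖z‖) →
        WaveletFrame.ApproximatesAtRate hM ψ ψ' n lam) ∧
      (∀ c : ℤ, M = c • (1 : Matrix (Fin d) (Fin d) ℤ) →
        WaveletFrame.ApproximatesAtRate hM ψ ψ' n |(c : ℝ)|) := by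
  have : NeZero d := ⟨hdual.frame.dim_ne_zero⟩
  have hmeas : ∀ ν, MeasureTheory.AEStronglyMeasurable (fun x ↦ ψ' ν x) := fun ν ↦
    (MeasureTheory.Lp.memLp (ψ' ν)).aestronglyMeasurable
  have hfour : ∀ ν, ∃ C : ℝ, 0 ≤ C ∧ ∀ η,
      ‖FourierTransform.fourier (fun x ↦ ψ' ν x) η‖ ≤ C * ‖η‖ ^ n := fun ν ↦
    WaveletFrame.norm_fourier_le_of_multiDeriv_eq_zero
      (fun l hl ↦ WaveletFrame.integrable_pow_mul_norm_of_decay hγ (hmeas ν) (hψ' ν) hl) (hmeas ν)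
      (fun α hα ↦ (hVM ν).2.2 α (by omega))
  choose C hC0 hC using hfour
  have hC' : ∀ ν η, ‖FourierTransform.fourier (fun x ↦ ψ' ν x) η‖ ≤ (∑ ν, C ν) * ‖η‖ ^ n := by
    intro ν η
    refine (hC ν η).trans ?_
    gcongr
    exact Finset.single_le_sum (fun ν _ ↦ hC0 ν) (Finset.mem_univ ν)
  have hrate : ∀ lam : ℝ, 1 < lam →
      (∀ z ∈ spectrum ℂ (M.map (Int.cast : ℤ → ℂ)), lam < ‖z‖) →
        WaveletFrame.ApproximatesAtRate hM ψ ψ' n lam := by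
    intro lam hlam h
    obtain ⟨K, hK⟩ := hM.exists_norm_dilation_symm_le (zero_lt_one.trans hlam) h
    exact WaveletFrame.approximatesAtRate_of_norm_le hn hdual (fun ν ↦ (hVM ν).1) hC' hlam hK
  refine ⟨?_, hrate, fun c hc ↦ ?_⟩
  · obtain ⟨lam, hlam, h⟩ := hM.exists_lt_norm
    exact ⟨lam, hlam, hrate lam hlam h⟩
  -- For scalar `M` the decay bound holds with `K = 1` and rate `|c|` itself, so no margin below the
  -- eigenvalue modulus is lost.
  · have h1 := hM.one_lt_abs_of_eq_smul_one hc
    have hc0 : c ≠ 0 := by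
      rintro rfl
      norm_num at h1
    exact WaveletFrame.approximatesAtRate_of_norm_le hn hdual (fun ν ↦ (hVM ν).1) hC' h1
      (hM.norm_dilation_symm_le_of_eq_smul_one hc0 hc)
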